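/- Let $V_0:\mathbb{R}^3\to\mathbb{R}$ be a bounded measurable function with $V_0\le 0$ and $V_0(r)=0$ for $|r|\ge r_V$, for some $r_V$. For a bounded measurable $V$ write $-\Delta+V\ge 0$ if $\int_{\mathbb{R}^3}\bigl(|\nabla f|^2+V|f|^2\bigr)\,dr\ge 0$ for all $f\in C_c^\infty(\mathbb{R}^3;\mathbb{C})$, and say that $V$ is at critical coupling (has a zero-energy resonance) if $-\Delta+V\ge 0$ while $-\Delta+(1+\varepsilon)V\not\ge 0$ for every $\varepsilon>0$. Assume that $V_0$ is at critical coupling. For $R>0$ let $\chi_R$ be the indicator function of $\{|r|\le R\}$ and $\eta_R$ the indicator function of $\{R<|r|\le 2R\}$. Then for every $R>0$ there is $\delta=\delta(R)>0$ such that for every $\lambda>-\delta$ there is exactly one $B=B_R(\lambda)\in\mathbb{R}$ for which $V_0+\lambda\chi_R-B\eta_R$ is at critical coupling; moreover $B_R(\lambda)\ge 0$ for all $\lambda\ge 0$, and $\delta$ can be chosen so that $B_R$ is differentiable at every point of $(-\delta,\delta)$. Furthermore $|B_R'(0)|$ stays bounded as $R\to\infty$: there are constants $C$ and $R_0$, depending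 only on $V_0$, with $|B_R'(0)|\le C$ for all $R\ge R_0$. -/

import Mathlib

open scoped ContDiff

noncomputable section

/-- Three-dimensional Euclidean space. -/
abbrev E3 : Type := EuclideanSpace ℝ (Fin 3)

/-- The quadratic form `⟨f, (-Δ + V) f⟩ = ∫ (|∇f|² + V |f|²)` of the Schrödinger operator `-Δ + V`,
where `|∇f|² = ∑ i, |∂ᵢ f|²`. It is used only for test functions `f` and bounded measurable `V`, for
which the integrand is integrable. -/
def schrodingerForm (V : E3 → ℝ) (f : E3 → ℂ) : ℝ :=
  ∫ x, ((∑ i : Fin 3, ‖fderiv ℝ f x (EuclideanSpace.single i 1)‖ ^ 2) + V x * ‖f x‖ ^ 2)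

/-- `-Δ + V ≥ 0`, tested on smooth compactly supported functions (a core of the operator and of its
form when `V` is bounded). -/
def SchrodingerNonneg (V : E3 → ℝ) : Prop :=
  ∀ f : E3 → ℂ, ContDiff ℝ ∞ f → HasCompactSupport f → 0 ≤ schrodingerForm V f

/-- Critical coupling (zero-energy resonance): `-Δ + V ≥ 0`, but for every `ε > 0` the form of
`-Δ + (1 + ε) V` takes a negative value. -/
def AtCriticalCoupling (V : E3 → ℝ) : Prop :=
  SchrodingerNonneg V ∧ ∀ ε : ℝ, 0 < ε → ¬ SchrodingerNonneg (fun x => (1 + ε) * V x)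

/-- The function `χ_R`, equal to `1` where `|r| ≤ R` and to `0` elsewhere. -/
def chiR (R : ℝ) : E3 → ℝ :=
  Set.indicator {r | ‖r‖ ≤ R} (fun _ => 1)

/-- The function `η_R`, equal to `1` where `R < |r| ≤ 2R` and to `0` elsewhere. -/
def etaR (R : ℝ) : E3 → ℝ :=
  Set.indicator {r | R < ‖r‖ ∧ ‖r‖ ≤ 2 * R} (fun _ => 1)

/-- The perturbed potential `V₀ + l χ_R - b η_R`. -/
def perturbedPotential (V₀ : E3 → ℝ) (R l b : ℝ) : E3 → ℝ :=
  fun r => V₀ r + l * chiR R r - b * etaR R r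

end

open scoped ContDiff

open MeasureTheory Filter Topology

noncomputable section

/-! ### Test functions and the bilinear form of `-Δ + V` -/

namespace CriticalCoupling

/-! The argument is variational and never solves the zero-energy equation. A ground state is an L²
limit, on a ball containing the support of V, of test functions f_n with `form V (f n) (f n) → 0`.
When `-Δ + V ≥ 0`, Cauchy–Schwarz for the form gives `form V (f n) (g n) → 0` whenever the forms of
the g_n stay bounded, which is the weak form of the equation (`FormNonneg.tendsto_zero`). The
Sobolev inequality and Rellich's theorem on balls turn normalised almost minimisers into nonzero
ground states, so critical coupling is equivalent to nonnegativity plus a nonzero ground state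
(`atCriticalCoupling_iff`).

Ground states are stable under linear combinations and absolute values. Testing with ζ²/(f+ε) bounds
the oscillation of log(f+ε) uniformly in ε, so a ground state vanishes almost everywhere or almost
nowhere. Applied to |u| + u this gives a constant sign, and hence uniqueness up to a factor
(`IsGround.exists_ae_eq_const_mul`).

Since a nonzero ground state has positive mass on the annulus, the critical b is the supremum
`critB` of the admissible ones and is unique. Small negative l is compensated by b = -1. With X and
Y the masses of the ground state u at l₀ on the ball and on the annulus, testing with u bounds
`critB` above by the line of slope X/Y through its value at l₀. If the matching lower bound failed,
almost minimisers would produce a second ground state with another ratio X/Y, against uniqueness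
(`hasDerivAt_critB`).

At l = 0 the ground state should decay like 1/|x|, making X and Y both of order R. Only X ≤ C₁R and
Y ≥ cR are needed. The first comes from testing with a bounded truncation of Rf and applying Sobolev
to a cube-root truncation (`exists_potForm_chiR_le`); the second from testing with a dilated cutoff
whose Laplacian lives on the annulus (`exists_le_potForm_etaR`). -/

/-- Real-valued smooth compactly supported functions on `ℝ³`. -/
structure IsTest (f : E3 → ℝ) : Prop where
  smooth : ContDiff ℝ ∞ f
  supp : HasCompactSupport f

/-- Bounded measurable potentials. -/
structure IsPotential (V : E3 → ℝ) : Prop where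
  meas : Measurable V
  bdd : ∃ M : ℝ, ∀ x, |V x| ≤ M

/-- The `i`-th partial derivative. -/
def pd (i : Fin 3) (f : E3 → ℝ) (x : E3) : ℝ := fderiv ℝ f x (EuclideanSpace.single i 1)

/-- The pointwise inner product of two gradients. -/
def gdot (f g : E3 → ℝ) (x : E3) : ℝ := ∑ i, pd i f x * pd i g x

/-- The Dirichlet form. -/
def dirichlet (f g : E3 → ℝ) : ℝ := ∫ x, gdot f g x

/-- The bilinear form of multiplication by `V`. -/
def potForm (V f g : E3 → ℝ) : ℝ := ∫ x, V x * (f x * g x)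

/-- The bilinear form of `-Δ + V` on real functions. -/
def form (V f g : E3 → ℝ) : ℝ := dirichlet f g + potForm V f g

/-- Nonnegativity of `-Δ + V` on real test functions. -/
def FormNonneg (V : E3 → ℝ) : Prop := ∀ f, IsTest f → 0 ≤ form V f f

namespace IsTest

variable {f g : E3 → ℝ}

lemma continuous (hf : IsTest f) : Continuous f := hf.smooth.continuous

lemma differentiable (hf : IsTest f) : Differentiable ℝ f := hf.smooth.differentiable (by simp)

lemma lin (hf : IsTest f) (hg : IsTest g) (a b : ℝ) : IsTest (fun x => a * f x + b * g x) where
  smooth := (contDiff_const.mul hf.smooth).add (contDiff_const.mul hg.smooth)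
  supp := (hf.supp.mul_left (f := fun _ => a)).add (hg.supp.mul_left (f := fun _ => b))

lemma const_mul (hf : IsTest f) (a : ℝ) : IsTest (fun x => a * f x) where
  smooth := contDiff_const.mul hf.smooth
  supp := hf.supp.mul_left (f := fun _ => a)

lemma mul_smooth (hf : IsTest f) (hg : ContDiff ℝ ∞ g) : IsTest (fun x => f x * g x) where
  smooth := hf.smooth.mul hg
  supp := hf.supp.mul_right

lemma continuous_pd (hf : IsTest f) (i : Fin 3) : Continuous (pd i f) :=
  (hf.smooth.continuous_fderiv (by simp)).clm_apply continuous_const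

lemma pd (hf : IsTest f) (i : Fin 3) : IsTest (pd i f) where
  smooth := (hf.smooth.fderiv_right (m := ∞) (by simp)).clm_apply contDiff_const
  supp := hf.supp.fderiv_apply ℝ _

lemma continuous_gdot (hf : IsTest f) (hg : IsTest g) : Continuous (gdot f g) :=
  continuous_finsetSum _ fun i _ => (hf.continuous_pd i).mul (hg.continuous_pd i)

lemma supp_gdot (hf : IsTest f) : HasCompactSupport (gdot f g) := by
  unfold gdot
  simp only [Fin.sum_univ_three]
  exact (((hf.pd 0).supp.mul_right).add (hf.pd 1).supp.mul_right).add (hf.pd 2).supp.mul_right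

lemma integrable (hf : IsTest f) : Integrable f :=
  hf.continuous.integrable_of_hasCompactSupport hf.supp

lemma integrable_gdot (hf : IsTest f) (hg : IsTest g) : Integrable (gdot f g) :=
  (hf.continuous_gdot hg).integrable_of_hasCompactSupport hf.supp_gdot

lemma integrable_pot {V : E3 → ℝ} (hV : IsPotential V) (hf : IsTest f) (hg : IsTest g) :
    Integrable (fun x => V x * (f x * g x)) := by
  obtain ⟨M, hM⟩ := hV.bdd
  exact (hf.mul_smooth hg.smooth).integrable.bdd_mul hV.meas.aestronglyMeasurable
    (Eventually.of_forall hM)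

end IsTest

lemma pd_lin {f g : E3 → ℝ} {x : E3} (hf : DifferentiableAt ℝ f x) (hg : DifferentiableAt ℝ g x)
    (a b : ℝ) (i : Fin 3) : pd i (fun x => a * f x + b * g x) x = a * pd i f x + b * pd i g x := by
  have h := (hf.hasFDerivAt.const_mul a).add (hg.hasFDerivAt.const_mul b)
  have h' : HasFDerivAt (fun x => a * f x + b * g x) (a • fderiv ℝ f x + b • fderiv ℝ g x) x := h
  simp [pd, h'.fderiv]

lemma pd_comp {f : E3 → ℝ} {x : E3} {θ : ℝ → ℝ} {θ' : ℝ} (hf : DifferentiableAt ℝ f x)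
    (hθ : HasDerivAt θ θ' (f x)) (i : Fin 3) :
    pd i (fun x => θ (f x)) x = θ' * pd i f x := by
  have h := hθ.comp_hasFDerivAt x hf.hasFDerivAt
  have h' : HasFDerivAt (fun x => θ (f x)) (θ' • fderiv ℝ f x) x := h
  simp [pd, h'.fderiv]

lemma pd_mul {f g : E3 → ℝ} {x : E3} (hf : DifferentiableAt ℝ f x) (hg : DifferentiableAt ℝ g x)
    (i : Fin 3) : pd i (fun x => f x * g x) x = f x * pd i g x + g x * pd i f x := by
  have h := hf.hasFDerivAt.mul hg.hasFDerivAt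
  have h' : HasFDerivAt (fun x => f x * g x) (f x • fderiv ℝ g x + g x • fderiv ℝ f x) x := h
  simp [pd, h'.fderiv]

lemma gdot_comm (f g : E3 → ℝ) (x : E3) : gdot f g x = gdot g f x := by
  simp [gdot, mul_comm]

lemma gdot_self_nonneg (f : E3 → ℝ) (x : E3) : 0 ≤ gdot f f x :=
  Finset.sum_nonneg fun _ _ => mul_self_nonneg _

lemma gdot_comp_right {f g : E3 → ℝ} {x : E3} {θ : ℝ → ℝ} {θ' : ℝ} (hg : DifferentiableAt ℝ g x)
    (hθ : HasDerivAt θ θ' (g x)) : gdot f (fun x => θ (g x)) x = θ' * gdot f g x := by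
  simp only [gdot, Finset.mul_sum, pd_comp hg hθ]
  exact Finset.sum_congr rfl fun i _ => by ring

lemma gdot_comp_self {f : E3 → ℝ} {x : E3} {θ : ℝ → ℝ} {θ' : ℝ} (hf : DifferentiableAt ℝ f x)
    (hθ : HasDerivAt θ θ' (f x)) :
    gdot (fun x => θ (f x)) (fun x => θ (f x)) x = θ' ^ 2 * gdot f f x := by
  rw [gdot_comp_right hf hθ, gdot_comm, gdot_comp_right hf hθ]; ring

lemma norm_fderiv_sq_le (f : E3 → ℝ) (x : E3) : ‖fderiv ℝ f x‖ ^ 2 ≤ gdot f f x := by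
  have h0 := gdot_self_nonneg f x
  have : ‖fderiv ℝ f x‖ ≤ Real.sqrt (gdot f f x) := by
    refine ContinuousLinearMap.opNorm_le_bound _ (Real.sqrt_nonneg _) fun v => ?_
    have hv : v = ∑ i, v i • EuclideanSpace.single i (1 : ℝ) := by
      ext j
      simp [Finset.sum_apply, Pi.single_apply]
    have h1 : fderiv ℝ f x v = ∑ i, v i * pd i f x := by
      conv_lhs => rw [hv]
      simp [pd]
    rw [h1, Real.norm_eq_abs]
    apply Real.abs_le_sqrt _ |>.trans
    swap
    · exact (∑ i, v i ^ 2) * ∑ i, pd i f x ^ 2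
    · rw [EuclideanSpace.norm_eq, mul_comm, Real.sqrt_mul (by positivity)]
      simp [gdot, sq]
    · exact Finset.sum_mul_sq_le_sq_mul_sq Finset.univ _ _
  calc ‖fderiv ℝ f x‖ ^ 2 ≤ Real.sqrt (gdot f f x) ^ 2 := by gcongr
    _ = _ := Real.sq_sqrt h0

lemma dirichlet_self_nonneg (f : E3 → ℝ) : 0 ≤ dirichlet f f :=
  integral_nonneg (gdot_self_nonneg f)

lemma form_comm (V f g : E3 → ℝ) : form V f g = form V g f := by
  simp [form, dirichlet, potForm, gdot_comm f g, mul_comm (f _)]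

lemma dirichlet_lin {f g h : E3 → ℝ} (hf : IsTest f) (hg : IsTest g) (hh : IsTest h) (a b : ℝ) :
    dirichlet (fun x => a * f x + b * g x) h = a * dirichlet f h + b * dirichlet g h := by
  unfold dirichlet
  rw [← integral_const_mul, ← integral_const_mul, ← integral_add]
  · congr 1; ext x
    simp only [gdot, pd_lin (hf.differentiable x) (hg.differentiable x), Finset.mul_sum,
      ← Finset.sum_add_distrib]
    exact Finset.sum_congr rfl fun i _ => by ring
  · exact (hf.integrable_gdot hh).const_mul a
  · exact (hg.integrable_gdot hh).const_mul b

lemma potForm_lin {V f g h : E3 → ℝ} (hV : IsPotential V) (hf : IsTest f) (hg : IsTest g)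
    (hh : IsTest h) (a b : ℝ) :
    potForm V (fun x => a * f x + b * g x) h = a * potForm V f h + b * potForm V g h := by
  unfold potForm
  rw [← integral_const_mul, ← integral_const_mul, ← integral_add]
  · congr 1; ext x; ring
  · exact (hf.integrable_pot hV hh).const_mul a
  · exact (hg.integrable_pot hV hh).const_mul b

lemma form_lin {V f g h : E3 → ℝ} (hV : IsPotential V) (hf : IsTest f) (hg : IsTest g)
    (hh : IsTest h) (a b : ℝ) :
    form V (fun x => a * f x + b * g x) h = a * form V f h + b * form V g h := by
  simp only [form, dirichlet_lin hf hg hh, potForm_lin hV hf hg hh]; ring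

lemma form_lin_self {V f g : E3 → ℝ} (hV : IsPotential V) (hf : IsTest f) (hg : IsTest g)
    (a b : ℝ) : form V (fun x => a * f x + b * g x) (fun x => a * f x + b * g x) =
      a ^ 2 * form V f f + 2 * a * b * form V f g + b ^ 2 * form V g g := by
  rw [form_lin hV hf hg (hf.lin hg a b), form_comm V f, form_comm V g,
    form_lin hV hf hg hf, form_lin hV hf hg hg, form_comm V g f]
  ring

lemma dirichlet_const_mul (f : E3 → ℝ) (a : ℝ) :
    dirichlet (fun x => a * f x) (fun x => a * f x) = a ^ 2 * dirichlet f f := by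
  unfold dirichlet
  rw [← integral_const_mul]
  congr 1; ext x
  have : ∀ i, pd i (fun x => a * f x) x = a * pd i f x := fun i => by
    have h' : fderiv ℝ (fun x => a * f x) x = a • fderiv ℝ f x :=
      congrFun (fderiv_const_smul_field (𝕜 := ℝ) (f := f) a) x
    simp [pd, h']
  simp only [gdot, this, Finset.mul_sum]
  exact Finset.sum_congr rfl fun i _ => by ring

lemma potForm_const_mul (V f : E3 → ℝ) (a : ℝ) :
    potForm V (fun x => a * f x) (fun x => a * f x) = a ^ 2 * potForm V f f := by
  unfold potForm
  rw [← integral_const_mul]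
  congr 1; ext x; ring

lemma form_const_mul (V f : E3 → ℝ) (a : ℝ) :
    form V (fun x => a * f x) (fun x => a * f x) = a ^ 2 * form V f f := by
  simp only [form, dirichlet_const_mul, potForm_const_mul]; ring

/-- The form along f + t g is a nonnegative quadratic in t, so its discriminant is nonpositive. -/
lemma FormNonneg.cauchy_schwarz {V f g : E3 → ℝ} (hV : IsPotential V) (h : FormNonneg V)
    (hf : IsTest f) (hg : IsTest g) : form V f g ^ 2 ≤ form V f f * form V g g := by
  have key : ∀ t : ℝ, 0 ≤ form V g g * (t * t) + 2 * form V f g * t + form V f f := fun t => by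
    have := h _ (hf.lin hg 1 t)
    rw [form_lin_self hV hf hg] at this
    linarith
  have := discrim_le_zero key
  unfold discrim at this
  linarith

/-- Parallelogram law: the form at a f - b g, which would complete the identity, is nonnegative and
is dropped. -/
lemma FormNonneg.lin_le {V f g : E3 → ℝ} (hV : IsPotential V) (h : FormNonneg V)
    (hf : IsTest f) (hg : IsTest g) (a b : ℝ) :
    form V (fun x => a * f x + b * g x) (fun x => a * f x + b * g x) ≤
      2 * a ^ 2 * form V f f + 2 * b ^ 2 * form V g g := by
  have := h _ (hf.lin hg a (-b))
  rw [form_lin_self hV hf hg] at this ⊢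
  linarith

/-- If `form V (f n) (f n) → 0` and `form V (g n) (g n)` stays bounded then
`form V (f n) (g n) → 0`. -/
lemma FormNonneg.tendsto_zero {V : E3 → ℝ} {f g : ℕ → E3 → ℝ} (hV : IsPotential V)
    (h : FormNonneg V) (hf : ∀ n, IsTest (f n)) (hg : ∀ n, IsTest (g n))
    (hlim : Tendsto (fun n => form V (f n) (f n)) atTop (𝓝 0)) {K : ℝ}
    (hK : ∀ n, form V (g n) (g n) ≤ K) :
    Tendsto (fun n => form V (f n) (g n)) atTop (𝓝 0) := by
  have h1 : Tendsto (fun n => Real.sqrt (form V (f n) (f n) * K)) atTop (𝓝 0) := by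
    simpa using (hlim.mul_const K).sqrt
  refine squeeze_zero_norm (fun n => ?_) h1
  refine Real.abs_le_sqrt ((h.cauchy_schwarz hV (hf n) (hg n)).trans ?_)
  exact mul_le_mul_of_nonneg_left (hK n) (h _ (hf n))

/-! ### Reduction to real-valued test functions -/

lemma schrodingerForm_ofReal {V f : E3 → ℝ} (hV : IsPotential V) (hf : IsTest f) :
    schrodingerForm V (fun x => (f x : ℂ)) = form V f f := by
  have h : ∀ x v, fderiv ℝ (fun x => (f x : ℂ)) x v = ((fderiv ℝ f x v : ℝ) : ℂ) := fun x v => by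
    have := Complex.ofRealCLM.hasFDerivAt.comp x (hf.differentiable x).hasFDerivAt
    have h' : HasFDerivAt (fun x => (f x : ℂ)) (Complex.ofRealCLM.comp (fderiv ℝ f x)) x := this
    simp [h'.fderiv]
  unfold schrodingerForm form dirichlet potForm
  rw [← integral_add (hf.integrable_gdot hf) (hf.integrable_pot hV hf)]
  congr 1; ext x
  simp [h, gdot, pd, sq]

lemma schrodingerForm_eq_re_add_im {V : E3 → ℝ} (hV : IsPotential V) {f : E3 → ℂ}
    (hf : ContDiff ℝ ∞ f) (hs : HasCompactSupport f) :
    IsTest (fun x => (f x).re) ∧ IsTest (fun x => (f x).im) ∧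
    schrodingerForm V f = form V (fun x => (f x).re) (fun x => (f x).re) +
      form V (fun x => (f x).im) (fun x => (f x).im) := by
  have h1 : IsTest (fun x => (f x).re) :=
    ⟨Complex.reCLM.contDiff.comp hf, hs.comp_left (g := Complex.re) rfl⟩
  have h2 : IsTest (fun x => (f x).im) :=
    ⟨Complex.imCLM.contDiff.comp hf, hs.comp_left (g := Complex.im) rfl⟩
  have hd : Differentiable ℝ f := hf.differentiable (by simp)
  have hre : ∀ x v, fderiv ℝ (fun x => (f x).re) x v = (fderiv ℝ f x v).re := fun x v => by
    have := Complex.reCLM.hasFDerivAt.comp x (hd x).hasFDerivAt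
    have h' : HasFDerivAt (fun x => (f x).re) (Complex.reCLM.comp (fderiv ℝ f x)) x := this
    simp [h'.fderiv]
  have him : ∀ x v, fderiv ℝ (fun x => (f x).im) x v = (fderiv ℝ f x v).im := fun x v => by
    have := Complex.imCLM.hasFDerivAt.comp x (hd x).hasFDerivAt
    have h' : HasFDerivAt (fun x => (f x).im) (Complex.imCLM.comp (fderiv ℝ f x)) x := this
    simp [h'.fderiv]
  refine ⟨h1, h2, ?_⟩
  unfold schrodingerForm form dirichlet potForm
  rw [← integral_add (h1.integrable_gdot h1) (h1.integrable_pot hV h1),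
    ← integral_add (h2.integrable_gdot h2) (h2.integrable_pot hV h2), ← integral_add]
  · congr 1; ext x
    simp only [gdot, pd, hre, him, Complex.sq_norm, Complex.normSq_apply, Fin.sum_univ_three]
    ring
  · exact (h1.integrable_gdot h1).add (h1.integrable_pot hV h1)
  · exact (h2.integrable_gdot h2).add (h2.integrable_pot hV h2)

/-- Nonnegativity may be tested on real-valued functions. -/
lemma schrodingerNonneg_iff {V : E3 → ℝ} (hV : IsPotential V) :
    SchrodingerNonneg V ↔ FormNonneg V := by
  constructor
  · intro h f hf
    rw [← schrodingerForm_ofReal hV hf]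
    exact h _ (Complex.ofRealCLM.contDiff.comp hf.smooth)
      (hf.supp.comp_left (g := fun t : ℝ => (t : ℂ)) (by simp))
  · intro h f hf hs
    obtain ⟨h1, h2, h3⟩ := schrodingerForm_eq_re_add_im hV hf hs
    rw [h3]
    exact add_nonneg (h _ h1) (h _ h2)

/-! ### Sobolev inequality and local L² control by the Dirichlet form -/

lemma IsTest.pow {f : E3 → ℝ} (hf : IsTest f) {k : ℕ} (hk : k ≠ 0) :
    IsTest (fun x => f x ^ k) where
  smooth := hf.smooth.pow k
  supp := hf.supp.comp_left (g := fun t : ℝ => t ^ k) (by simp [hk])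

/-- The Sobolev inequality in dimension three. -/
lemma exists_sobolev_const :
    ∃ C : ℝ, 0 ≤ C ∧ ∀ f, IsTest f → ∫ x, f x ^ 6 ≤ C * dirichlet f f ^ 3 := by
  obtain ⟨C, hC⟩ : ∃ C : NNReal, ∀ f, IsTest f →
      eLpNorm f 6 volume ≤ C * eLpNorm (fderiv ℝ f) 2 volume := by
    refine ⟨eLpNormLESNormFDerivOfEqInnerConst (volume : Measure E3) 2, fun f hf => ?_⟩
    have := eLpNorm_le_eLpNorm_fderiv_of_eq_inner (volume : Measure E3)
      (hf.smooth.of_le (by simp)) hf.supp (p := 2) (p' := 6) (by norm_num) (by simp) (by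
        simp; norm_num)
    simpa using this
  refine ⟨C ^ 6, by positivity, fun f hf => ?_⟩
  have hfd : Continuous (fderiv ℝ f) := hf.smooth.continuous_fderiv (by simp)
  have hfs : HasCompactSupport (fderiv ℝ f) := hf.supp.fderiv ℝ
  have h1 := hC f hf
  rw [(hf.continuous.memLp_of_hasCompactSupport hf.supp).eLpNorm_eq_integral_rpow_norm
      (by norm_num) (by norm_num),
    (hfd.memLp_of_hasCompactSupport hfs).eLpNorm_eq_integral_rpow_norm
      (by norm_num) (by norm_num), ENNReal.coe_nnreal_eq, ← ENNReal.ofReal_mul C.coe_nonneg,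
    ENNReal.ofReal_le_ofReal_iff (by positivity)] at h1
  simp only [ENNReal.toReal_ofNat] at h1
  have e6 : ∀ x, ‖f x‖ ^ (6 : ℝ) = f x ^ 6 := fun x => by
    rw [← Even.pow_abs (n := 6) (by decide)]; exact_mod_cast rfl
  have e2 : ∀ x, ‖fderiv ℝ f x‖ ^ (2 : ℝ) = ‖fderiv ℝ f x‖ ^ 2 := fun x => by norm_cast
  simp only [e6, e2] at h1
  have hle : ∫ x, ‖fderiv ℝ f x‖ ^ 2 ≤ dirichlet f f :=
    integral_mono_of_nonneg (Eventually.of_forall fun x => by positivity)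
      (hf.integrable_gdot hf) (Eventually.of_forall (norm_fderiv_sq_le f))
  have hI : 0 ≤ ∫ x, ‖fderiv ℝ f x‖ ^ 2 := integral_nonneg fun x => by positivity
  have hJ : 0 ≤ ∫ x, f x ^ 6 := integral_nonneg fun x => by positivity
  calc ∫ x, f x ^ 6 = ((∫ x, f x ^ 6) ^ ((6 : ℝ)⁻¹)) ^ (6 : ℕ) := by
        rw [← Real.rpow_natCast, ← Real.rpow_mul hJ]; norm_num
    _ ≤ (C * (∫ x, ‖fderiv ℝ f x‖ ^ 2) ^ ((2 : ℝ)⁻¹)) ^ (6 : ℕ) := by gcongr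
    _ = C ^ 6 * (∫ x, ‖fderiv ℝ f x‖ ^ 2) ^ 3 := by
        rw [mul_pow, ← Real.rpow_natCast ((∫ x, ‖fderiv ℝ f x‖ ^ 2) ^ _), ← Real.rpow_mul hI]
        norm_num
    _ ≤ _ := by gcongr

/-- A test function is controlled in `L²` of a set of finite measure by its Dirichlet norm. -/
lemma exists_local_const (s : Set E3) (hs : volume s ≠ ⊤) :
    ∃ C : ℝ, 0 < C ∧ ∀ f, IsTest f → ∫ x in s, f x ^ 2 ≤ C * dirichlet f f := by
  obtain ⟨C, hC0, hC⟩ := exists_sobolev_const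
  refine ⟨volume.real s + C + 1, by positivity, fun f hf => ?_⟩
  have h6 := hC f hf
  have i6 : Integrable (fun x => f x ^ 6) := (hf.pow (by norm_num)).integrable
  have i2 : Integrable (fun x => f x ^ 2) := (hf.pow (by norm_num)).integrable
  -- The pointwise bound below divides by the Dirichlet form; when that is zero, Sobolev already
  -- forces f = 0 almost everywhere.
  rcases (dirichlet_self_nonneg f).eq_or_lt with h0 | h0
  · rw [← h0] at h6 ⊢
    have : ∫ x, f x ^ 6 = 0 := le_antisymm (by simpa using h6) (integral_nonneg fun x => by positivity)
    rw [integral_eq_zero_iff_of_nonneg (fun x => by positivity) i6] at this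
    have h2 : (fun x => f x ^ 2) =ᵐ[volume.restrict s] 0 := by
      refine ae_restrict_of_ae ?_
      filter_upwards [this] with x hx
      have : f x = 0 := by simpa using hx
      simp [this]
    rw [integral_congr_ae h2]; simp
  · set E := dirichlet f f
    -- This is t ≤ 1 + t³ at t = f²/E, chosen so that Sobolev turns the sixth power into a multiple
    -- of E. It replaces Hölder's inequality.
    have pw : ∀ x, f x ^ 2 ≤ E + (E ^ 2)⁻¹ * f x ^ 6 := fun x => by
      have : f x ^ 2 = E * (f x ^ 2 / E) := by field_simp
      have h3 : f x ^ 2 / E ≤ 1 + (f x ^ 2 / E) ^ 3 := by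
        have : 0 ≤ f x ^ 2 / E := by positivity
        set t := f x ^ 2 / E
        nlinarith [mul_nonneg this (sq_nonneg (t - 1)), sq_nonneg (t - 1)]
      calc f x ^ 2 = E * (f x ^ 2 / E) := this
        _ ≤ E * (1 + (f x ^ 2 / E) ^ 3) := by gcongr
        _ = _ := by field_simp
    have ic : Integrable (fun _ : E3 => E) (volume.restrict s) := integrableOn_const hs
    calc ∫ x in s, f x ^ 2 ≤ ∫ x in s, (E + (E ^ 2)⁻¹ * f x ^ 6) :=
          integral_mono i2.restrict (ic.add (i6.restrict.const_mul _)) pw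
      _ = volume.real s * E + (E ^ 2)⁻¹ * ∫ x in s, f x ^ 6 := by
          rw [integral_add ic (i6.restrict.const_mul _), integral_const_mul]
          simp
      _ ≤ volume.real s * E + (E ^ 2)⁻¹ * (C * E ^ 3) := by
          gcongr
          exact (setIntegral_le_integral i6 (Eventually.of_forall fun x => by positivity)).trans h6
      _ = (volume.real s + C) * E := by field_simp
      _ ≤ _ := by nlinarith

/-! ### Translation estimates and local averages -/

/-- The increment is the mean over [0, 1] of the directional derivative along the segment, and the
square of a mean is at most the mean of the squares because the variance is nonnegative. -/
lemma sq_sub_le_lintegral {f : E3 → ℝ} (hf : ContDiff ℝ 1 f) (x z : E3) :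
    ENNReal.ofReal ((f (x + z) - f x) ^ 2) ≤
      ∫⁻ t in Set.Ioc (0 : ℝ) 1, ENNReal.ofReal (‖z‖ ^ 2 * ‖fderiv ℝ f (x + t • z)‖ ^ 2) := by
  have hfd : Continuous (fderiv ℝ f) := hf.continuous_fderiv (by simp)
  have hc : Continuous fun t : ℝ => fderiv ℝ f (x + t • z) z := by fun_prop
  have hder : ∀ t : ℝ, HasDerivAt (fun t : ℝ => f (x + t • z)) (fderiv ℝ f (x + t • z) z) t := by
    intro t
    have h1 : HasDerivAt (fun t : ℝ => x + t • z) z t := by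
      simpa using ((hasDerivAt_id t).smul_const z).const_add x
    exact ((hf.differentiable (by simp)) _).hasFDerivAt.comp_hasDerivAt t h1
  have hFTC := intervalIntegral.integral_eq_sub_of_hasDerivAt (a := 0) (b := 1)
    (fun t _ => hder t) (hc.intervalIntegrable _ _)
  simp only [one_smul, zero_smul, add_zero] at hFTC
  set m := f (x + z) - f x
  have hsq : m ^ 2 ≤ ∫ t in (0 : ℝ)..1, (fderiv ℝ f (x + t • z) z) ^ 2 := by
    have h0 : 0 ≤ ∫ t in (0 : ℝ)..1, (fderiv ℝ f (x + t • z) z - m) ^ 2 :=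
      intervalIntegral.integral_nonneg (by norm_num) fun t _ => sq_nonneg _
    have h1 : ∫ t in (0 : ℝ)..1, (fderiv ℝ f (x + t • z) z - m) ^ 2 =
        (∫ t in (0 : ℝ)..1, (fderiv ℝ f (x + t • z) z) ^ 2) - m ^ 2 := by
      have : ∀ t : ℝ, (fderiv ℝ f (x + t • z) z - m) ^ 2 =
        (fderiv ℝ f (x + t • z) z) ^ 2 - (2 * m) * (fderiv ℝ f (x + t • z) z) + m ^ 2 :=
          fun t => by ring
      simp only [this]
      rw [intervalIntegral.integral_add, intervalIntegral.integral_sub,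
        intervalIntegral.integral_const_mul, hFTC]
      · simp; ring
      all_goals exact Continuous.intervalIntegrable (by fun_prop) _ _
    linarith
  calc ENNReal.ofReal (m ^ 2) ≤ ENNReal.ofReal (∫ t in (0 : ℝ)..1, (fderiv ℝ f (x + t • z) z) ^ 2) :=
        ENNReal.ofReal_le_ofReal hsq
    _ = ∫⁻ t in Set.Ioc (0 : ℝ) 1, ENNReal.ofReal ((fderiv ℝ f (x + t • z) z) ^ 2) := by
        rw [intervalIntegral.integral_of_le (by norm_num)]
        refine ofReal_integral_eq_lintegral_ofReal ?_ (Eventually.of_forall fun t => sq_nonneg _)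
        exact (Continuous.intervalIntegrable (by fun_prop) _ _ :
          IntervalIntegrable (fun t : ℝ => (fderiv ℝ f (x + t • z) z) ^ 2) volume 0 1).1
    _ ≤ _ := by
        refine lintegral_mono fun t => ENNReal.ofReal_le_ofReal ?_
        have := (fderiv ℝ f (x + t • z)).le_opNorm z
        rw [← sq_abs, ← mul_pow, mul_comm]
        exact pow_le_pow_left₀ (abs_nonneg _) this 2

/-- The `L²` translation estimate. -/
lemma lintegral_sq_sub_translate_le {f : E3 → ℝ} (hf : ContDiff ℝ 1 f) {s s' : Set E3}
    (hs : MeasurableSet s) (hs' : MeasurableSet s') (z : E3)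
    (hss : ∀ x ∈ s, ∀ t ∈ Set.Ioc (0 : ℝ) 1, x + t • z ∈ s') :
    ∫⁻ x in s, ENNReal.ofReal ((f (x + z) - f x) ^ 2) ≤
      ENNReal.ofReal (‖z‖ ^ 2) * ∫⁻ x in s', ENNReal.ofReal (‖fderiv ℝ f x‖ ^ 2) := by
  have hfd : Continuous (fderiv ℝ f) := hf.continuous_fderiv (by simp)
  set F : E3 → ENNReal := fun x => ENNReal.ofReal (‖z‖ ^ 2 * ‖fderiv ℝ f x‖ ^ 2)
  have hF : Measurable F := (by fun_prop : Continuous fun x =>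
    (‖z‖ ^ 2 * ‖fderiv ℝ f x‖ ^ 2)).measurable.ennreal_ofReal
  calc ∫⁻ x in s, ENNReal.ofReal ((f (x + z) - f x) ^ 2)
      ≤ ∫⁻ x in s, ∫⁻ t in Set.Ioc (0 : ℝ) 1, F (x + t • z) :=
        lintegral_mono fun x => sq_sub_le_lintegral hf x z
    _ = ∫⁻ t in Set.Ioc (0 : ℝ) 1, ∫⁻ x in s, F (x + t • z) := by
        refine lintegral_lintegral_swap (Measurable.aemeasurable ?_)
        exact hF.comp (by fun_prop)
    _ ≤ ∫⁻ t in Set.Ioc (0 : ℝ) 1, ∫⁻ x in s', F x := by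
        refine setLIntegral_mono measurable_const fun t ht => ?_
        rw [← lintegral_indicator hs, ← lintegral_indicator hs',
          ← lintegral_add_right_eq_self (s'.indicator F) (t • z)]
        refine lintegral_mono fun x => ?_
        by_cases hx : x ∈ s
        · rw [Set.indicator_of_mem hx, Set.indicator_of_mem (hss x hx t ht)]
        · rw [Set.indicator_of_notMem hx]; exact zero_le
    _ = ∫⁻ x in s', F x := by simp
    _ = _ := by
        simp only [F, ENNReal.ofReal_mul (sq_nonneg ‖z‖)]
        rw [lintegral_const_mul]
        exact (by fun_prop : Continuous fun x => (‖fderiv ℝ f x‖ ^ 2)).measurable.ennreal_ofReal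

lemma sq_integral_le {α : Type*} [MeasurableSpace α] {μ : Measure α} [IsFiniteMeasure μ]
    {g : α → ℝ} (h1 : Integrable g μ) (h2 : Integrable (fun x => g x ^ 2) μ) :
    (∫ x, g x ∂μ) ^ 2 ≤ μ.real Set.univ * ∫ x, g x ^ 2 ∂μ := by
  have key : ∀ t : ℝ, 0 ≤ (∫ x, g x ^ 2 ∂μ) * (t * t) + (-2 * ∫ x, g x ∂μ) * t +
      μ.real Set.univ := fun t => by
    have h0 : 0 ≤ ∫ x, (t * g x - 1) ^ 2 ∂μ := integral_nonneg fun x => sq_nonneg _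
    have : ∀ x, (t * g x - 1) ^ 2 = t ^ 2 * g x ^ 2 - 2 * t * g x + 1 := fun x => by ring
    simp only [this] at h0
    have h3 : Integrable (fun x => t ^ 2 * g x ^ 2 - 2 * t * g x) μ :=
      (h2.const_mul _).sub (h1.const_mul _)
    rw [integral_add h3 (integrable_const _), integral_sub (h2.const_mul _) (h1.const_mul _), integral_const_mul, integral_const_mul] at h0
    simp only [integral_const, smul_eq_mul, mul_one] at h0
    linarith
  have := discrim_le_zero key
  unfold discrim at this
  linarith

/-- The restriction of Lebesgue measure to the closed ball of radius `ρ`. -/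
abbrev ballMeasure (ρ : ℝ) : Measure E3 := volume.restrict (Metric.closedBall 0 ρ)

instance (ρ : ℝ) : IsFiniteMeasure (ballMeasure ρ) :=
  ⟨by rw [Measure.restrict_apply_univ]; exact measure_closedBall_lt_top⟩

lemma isPotential_zero : IsPotential 0 := ⟨measurable_const, 0, by simp⟩

lemma form_zero (f g : E3 → ℝ) : form 0 f g = dirichlet f g := by simp [form, potForm]

lemma formNonneg_zero : FormNonneg 0 := fun f _ => by
  rw [form_zero]; exact dirichlet_self_nonneg f

lemma lintegral_gdot {f : E3 → ℝ} (hf : IsTest f) :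
    ∫⁻ x, ENNReal.ofReal (gdot f f x) = ENNReal.ofReal (dirichlet f f) :=
  (ofReal_integral_eq_lintegral_ofReal (hf.integrable_gdot hf)
    (Eventually.of_forall (gdot_self_nonneg f))).symm

lemma lintegral_translate_le {f : E3 → ℝ} (hf : IsTest f) (z : E3) :
    ∫⁻ x, ENNReal.ofReal ((f (x + z) - f x) ^ 2) ≤ ENNReal.ofReal (‖z‖ ^ 2 * dirichlet f f) := by
  have h := lintegral_sq_sub_translate_le (hf.smooth.of_le (by simp)) MeasurableSet.univ
    MeasurableSet.univ z (by simp)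
  rw [setLIntegral_univ, setLIntegral_univ] at h
  refine h.trans ?_
  rw [ENNReal.ofReal_mul (by positivity), ← lintegral_gdot hf]
  gcongr with x
  exact norm_fderiv_sq_le f x

/-- Jensen's inequality on the ball around c, which lies inside the ball of radius 2h around x.
Passing to the displacement z leaves a domain independent of x, so the bound can be integrated in x
by the translation estimate. -/
lemma sq_sub_average_le {f : E3 → ℝ} (hf : IsTest f) (c x : E3) {h : ℝ} (hh : 0 < h)
    (hx : x ∈ Metric.ball c h) :
    (f x - ⨍ w in Metric.ball c h, f w) ^ 2 ≤
      (volume.real (Metric.ball c h))⁻¹ *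
        ∫ z in Metric.ball (0 : E3) (2 * h), (f (x + z) - f x) ^ 2 := by
  set v := volume.real (Metric.ball c h)
  have hv : 0 < v := ENNReal.toReal_pos (Metric.measure_ball_pos _ _ hh).ne'
    measure_ball_lt_top.ne
  have hcont := hf.continuous
  have hI : ∀ g : E3 → ℝ, Continuous g → ∀ (a : E3) (r : ℝ),
      IntegrableOn g (Metric.ball a r) := fun g hg a r =>
    (hg.continuousOn.integrableOn_compact (isCompact_closedBall a r)).mono_set
      Metric.ball_subset_closedBall
  have : IsFiniteMeasure (volume.restrict (Metric.ball c h)) :=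
    ⟨by rw [Measure.restrict_apply_univ]; exact measure_ball_lt_top⟩
  have h1 := sq_integral_le (μ := volume.restrict (Metric.ball c h)) (g := fun w => f w - f x)
    (hI _ (by fun_prop) _ _) (hI _ (by fun_prop) _ _)
  have h2 : ∫ w in Metric.ball c h, (f w - f x) =
      v * ((⨍ w in Metric.ball c h, f w) - f x) := by
    rw [integral_sub (hI _ hcont _ _) (hI _ continuous_const _ _), setAverage_eq]
    simp only [integral_const, smul_eq_mul, measureReal_restrict_apply_univ]
    change _ - v * f x = v * (v⁻¹ * _ - f x)
    field_simp
  have h3 : ∫ w in Metric.ball c h, (f w - f x) ^ 2 ≤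
      ∫ z in Metric.ball (0 : E3) (2 * h), (f (x + z) - f x) ^ 2 := by
    have e : ∫ z in Metric.ball (0 : E3) (2 * h), (f (x + z) - f x) ^ 2 =
        ∫ w in Metric.ball x (2 * h), (f w - f x) ^ 2 := by
      rw [← integral_indicator measurableSet_ball, ← integral_indicator measurableSet_ball,
        ← integral_add_left_eq_self ((Metric.ball x (2 * h)).indicator fun w => (f w - f x) ^ 2) x]
      refine integral_congr_ae (Eventually.of_forall fun z => ?_)
      simp only [Set.indicator, mem_ball_iff_norm, add_sub_cancel_left, sub_zero]
    rw [e]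
    refine setIntegral_mono_set (hI _ (by fun_prop) _ _)
      (Eventually.of_forall fun w => sq_nonneg _) ?_
    refine (Metric.ball_subset_ball' ?_).eventuallyLE
    rw [Metric.mem_ball'] at hx
    linarith
  rw [h2, measureReal_restrict_apply_univ] at h1
  rw [← mul_le_mul_iff_right₀ hv, ← mul_assoc, mul_inv_cancel₀ hv.ne', one_mul,
    ← mul_le_mul_iff_right₀ hv]
  calc v * (v * (f x - ⨍ w in Metric.ball c h, f w) ^ 2)
      = (v * ((⨍ w in Metric.ball c h, f w) - f x)) ^ 2 := by ring
    _ ≤ _ := h1.trans (by gcongr)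

/-- Up to a small multiple of the Dirichlet form, the local `L²` norm is controlled by finitely
many averages. -/
lemma exists_finite_averages (ρ : ℝ) {ε : ℝ} (hε : 0 < ε) :
    ∃ (t : Finset E3) (h C : ℝ), 0 < h ∧ 0 ≤ C ∧ ∀ f, IsTest f →
      ∫ x, f x ^ 2 ∂(ballMeasure ρ) ≤
        ε * dirichlet f f + C * ∑ c ∈ t, (⨍ w in Metric.ball c h, f w) ^ 2 := by
  -- The final coefficient of the Dirichlet form is 2v⁻¹ · 8v · (2h)² = 64h², where v and 8v are the
  -- volumes of the balls of radii h and 2h.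
  obtain ⟨h, hh, hhε⟩ : ∃ h : ℝ, 0 < h ∧ 64 * h ^ 2 ≤ ε := by
    refine ⟨Real.sqrt (ε / 64), by positivity, ?_⟩
    rw [Real.sq_sqrt (by positivity)]; linarith
  obtain ⟨t, -, htf, ht⟩ := Metric.finite_approx_of_totallyBounded
    (isCompact_closedBall (0 : E3) ρ).totallyBounded h hh
  refine ⟨htf.toFinset, h, 2 * volume.real (Metric.closedBall (0 : E3) ρ), hh, by positivity,
    fun f hf => ?_⟩
  set S := ∑ c ∈ htf.toFinset, (⨍ w in Metric.ball c h, f w) ^ 2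
  have hS : 0 ≤ S := Finset.sum_nonneg fun _ _ => sq_nonneg _
  set v := volume.real (Metric.ball (0 : E3) h)
  have hv : 0 < v := ENNReal.toReal_pos (Metric.measure_ball_pos _ _ hh).ne'
    measure_ball_lt_top.ne
  have hv2 : volume (Metric.ball (0 : E3) (2 * h)) = ENNReal.ofReal (8 * v) := by
    have := Measure.addHaar_ball_mul (volume : Measure E3) 0 (r := 2) (by norm_num) h
    rw [this, ENNReal.ofReal_mul (by norm_num)]
    simp only [finrank_euclideanSpace, Fintype.card_fin, v]
    rw [Measure.real, ENNReal.ofReal_toReal measure_ball_lt_top.ne]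
    norm_num
  have hcont := hf.continuous
  set J : E3 → ℝ := fun x => ∫ z in Metric.ball (0 : E3) (2 * h), (f (x + z) - f x) ^ 2
  have pw : ∀ x ∈ Metric.closedBall (0 : E3) ρ, f x ^ 2 ≤ 2 * v⁻¹ * J x + 2 * S := by
    intro x hx
    obtain ⟨c, hc, hxc⟩ := Set.mem_iUnion₂.1 (ht hx)
    have h1 := sq_sub_average_le hf c x hh hxc
    have h2 : volume.real (Metric.ball c h) = v := by
      simp only [v, Measure.real, Measure.addHaar_ball_center]
    rw [h2] at h1
    have h3 : (⨍ w in Metric.ball c h, f w) ^ 2 ≤ S :=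
      Finset.single_le_sum (f := fun c => (⨍ w in Metric.ball c h, f w) ^ 2)
        (fun _ _ => sq_nonneg _) (htf.mem_toFinset.2 hc)
    nlinarith [sq_nonneg (f x - 2 * ⨍ w in Metric.ball c h, f w)]
  have hJ : ∀ x, ENNReal.ofReal (J x) =
      ∫⁻ z in Metric.ball (0 : E3) (2 * h), ENNReal.ofReal ((f (x + z) - f x) ^ 2) := fun x =>
    ofReal_integral_eq_lintegral_ofReal
      (((by fun_prop : Continuous fun z => (f (x + z) - f x) ^ 2).continuousOn.integrableOn_compact
        (isCompact_closedBall 0 (2 * h))).mono_set Metric.ball_subset_closedBall)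
      (Eventually.of_forall fun z => sq_nonneg _)
  have hmeas : Measurable (Function.uncurry fun x z : E3 =>
      ENNReal.ofReal ((f (x + z) - f x) ^ 2)) :=
    (by fun_prop : Continuous fun p : E3 × E3 => (f (p.1 + p.2) - f p.1) ^ 2).measurable.ennreal_ofReal
  have hJint : ∫⁻ x, ENNReal.ofReal (J x) ≤ ENNReal.ofReal (8 * v * ((2 * h) ^ 2 * dirichlet f f)) := by
    simp only [hJ]
    rw [lintegral_lintegral_swap hmeas.aemeasurable]
    calc _ ≤ ∫⁻ z in Metric.ball (0 : E3) (2 * h), ENNReal.ofReal ((2 * h) ^ 2 * dirichlet f f) := by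
          refine setLIntegral_mono measurable_const fun z hz => ?_
          refine (lintegral_translate_le hf z).trans (ENNReal.ofReal_le_ofReal ?_)
          have := dirichlet_self_nonneg f
          have hz' : ‖z‖ ≤ 2 * h := by simpa using (mem_ball_zero_iff.1 hz).le
          gcongr
      _ = _ := by
          rw [setLIntegral_const, hv2, mul_comm, ← ENNReal.ofReal_mul (by positivity)]
  have hE := dirichlet_self_nonneg f
  have main : ENNReal.ofReal (∫ x, f x ^ 2 ∂(ballMeasure ρ)) ≤ ENNReal.ofReal
      (2 * v⁻¹ * (8 * v * ((2 * h) ^ 2 * dirichlet f f)) +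
        2 * S * volume.real (Metric.closedBall (0 : E3) ρ)) := by
    rw [ofReal_integral_eq_lintegral_ofReal
      ((hf.pow (two_ne_zero)).integrable.restrict) (Eventually.of_forall fun z => sq_nonneg _)]
    calc _ ≤ ∫⁻ x in Metric.closedBall (0 : E3) ρ,
            (ENNReal.ofReal (2 * v⁻¹) * ENNReal.ofReal (J x) + ENNReal.ofReal (2 * S)) := by
          refine setLIntegral_mono' measurableSet_closedBall fun x hx => ?_
          rw [← ENNReal.ofReal_mul (by positivity), ← ENNReal.ofReal_add _ (by positivity)]
          · exact ENNReal.ofReal_le_ofReal (pw x hx)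
          · have : 0 ≤ J x := integral_nonneg fun z => sq_nonneg _
            positivity
      _ = ENNReal.ofReal (2 * v⁻¹) * (∫⁻ x in Metric.closedBall (0 : E3) ρ, ENNReal.ofReal (J x)) +
            ENNReal.ofReal (2 * S) * volume (Metric.closedBall (0 : E3) ρ) := by
          rw [lintegral_add_right _ measurable_const, setLIntegral_const,
            lintegral_const_mul' _ _ ENNReal.ofReal_ne_top]
      _ ≤ ENNReal.ofReal (2 * v⁻¹) * ENNReal.ofReal (8 * v * ((2 * h) ^ 2 * dirichlet f f)) +
            ENNReal.ofReal (2 * S) * ENNReal.ofReal (volume.real (Metric.closedBall (0 : E3) ρ)) := by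
          gcongr
          · exact (setLIntegral_le_lintegral _ _).trans hJint
          · rw [Measure.real, ENNReal.ofReal_toReal measure_closedBall_lt_top.ne]
      _ = _ := by
          rw [← ENNReal.ofReal_mul (by positivity), ← ENNReal.ofReal_mul (by positivity),
            ← ENNReal.ofReal_add (by positivity) (by positivity)]
  rw [ENNReal.ofReal_le_ofReal_iff (by positivity)] at main
  refine main.trans ?_
  have e : 2 * v⁻¹ * (8 * v * ((2 * h) ^ 2 * dirichlet f f)) = 64 * h ^ 2 * dirichlet f f := by
    field_simp; ring
  rw [e]
  nlinarith [mul_le_mul_of_nonneg_right hhε hE]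

/-! ### Compactness on balls -/

lemma norm_toLp_sq {α : Type*} [MeasurableSpace α] {μ : Measure α} {g : α → ℝ}
    (hg : MemLp g 2 μ) : ‖hg.toLp g‖ ^ 2 = ∫ x, g x ^ 2 ∂μ := by
  have h0 : 0 ≤ ∫ x, g x ^ 2 ∂μ := integral_nonneg fun x => sq_nonneg _
  rw [Lp.norm_toLp, hg.eLpNorm_eq_integral_rpow_norm (by norm_num) (by norm_num)]
  have : ∀ x, ‖g x‖ ^ (2 : ℝ) = g x ^ 2 := fun x => by
    rw [← sq_abs]; exact_mod_cast rfl
  simp only [ENNReal.toReal_ofNat, this]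
  rw [ENNReal.toReal_ofReal (by positivity), ← Real.rpow_natCast, ← Real.rpow_mul h0]
  norm_num

lemma IsTest.memLp {f : E3 → ℝ} (hf : IsTest f) (ρ : ℝ) : MemLp f 2 (ballMeasure ρ) :=
  (hf.continuous.memLp_of_hasCompactSupport hf.supp).restrict _

lemma dirichlet_sub_le {f g : E3 → ℝ} (hf : IsTest f) (hg : IsTest g) :
    dirichlet (fun x => f x - g x) (fun x => f x - g x) ≤
      2 * dirichlet f f + 2 * dirichlet g g := by
  have := formNonneg_zero.lin_le isPotential_zero hf hg 1 (-1)
  simp only [form_zero] at this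
  simpa [sub_eq_add_neg] using this

lemma IsTest.sub {f g : E3 → ℝ} (hf : IsTest f) (hg : IsTest g) :
    IsTest (fun x => f x - g x) := by
  simpa [sub_eq_add_neg] using hf.lin hg 1 (-1)

/-- **Rellich's theorem** on balls: a sequence of test functions with bounded Dirichlet norm has a
subsequence converging in `L²` of a given ball. -/
theorem exists_subseq_tendsto (ρ : ℝ) {f : ℕ → E3 → ℝ} (hf : ∀ n, IsTest (f n)) {K : ℝ}
    (hK : ∀ n, dirichlet (f n) (f n) ≤ K) :
    ∃ φ : ℕ → ℕ, StrictMono φ ∧ ∃ u : E3 → ℝ, MemLp u 2 (ballMeasure ρ) ∧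
      Tendsto (fun n => ∫ x, (f (φ n) x - u x) ^ 2 ∂(ballMeasure ρ)) atTop (𝓝 0) := by
  have hK0 : 0 ≤ K := (dirichlet_self_nonneg _).trans (hK 0)
  set F : ℕ → Lp ℝ 2 (ballMeasure ρ) := fun n => ((hf n).memLp ρ).toLp (f n)
  have hF : ∀ m n, ‖F m - F n‖ ^ 2 = ∫ x, (f m x - f n x) ^ 2 ∂(ballMeasure ρ) := fun m n => by
    simp only [F]
    rw [← MemLp.toLp_sub, norm_toLp_sq]
    rfl
  have htb : TotallyBounded (Set.range F) := by
    rw [Metric.totallyBounded_iff]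
    intro ε hε
    -- A difference of two members has Dirichlet form at most 4K, so this choice leaves at most ε²/2
    -- for the Dirichlet term and the rest for the finitely many averages.
    obtain ⟨t, h, C, hh, hC, hbound⟩ := exists_finite_averages ρ
      (ε := ε ^ 2 / (8 * (K + 1))) (by positivity)
    set a : ℕ → (t → ℝ) := fun n c => ⨍ w in Metric.ball (c : E3) h, f n w
    -- The averages form a bounded set in a finite-dimensional space; a finite net for them will
    -- give one for the functions.
    have ha : TotallyBounded (Set.range a) := by
      obtain ⟨C', hC', hl⟩ : ∃ C' : ℝ, 0 ≤ C' ∧ ∀ (c : t) n, |a n c| ≤ C' := by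
        choose D hD0 hD using fun c : E3 => exists_local_const (Metric.ball c h)
          measure_ball_lt_top.ne
        set v := fun c : E3 => volume.real (Metric.ball c h)
        have hv : ∀ c, 0 < v c := fun c => ENNReal.toReal_pos
          (Metric.measure_ball_pos _ _ hh).ne' measure_ball_lt_top.ne
        refine ⟨∑ c ∈ t, Real.sqrt ((v c)⁻¹ * (D c * K)),
          Finset.sum_nonneg fun _ _ => Real.sqrt_nonneg _, fun c n => ?_⟩
        refine le_trans ?_ (Finset.single_le_sum
          (f := fun c => Real.sqrt ((v c)⁻¹ * (D c * K))) (fun _ _ => Real.sqrt_nonneg _) c.2)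
        refine Real.abs_le_sqrt ?_
        have : IsFiniteMeasure (volume.restrict (Metric.ball (c : E3) h)) :=
          ⟨by rw [Measure.restrict_apply_univ]; exact measure_ball_lt_top⟩
        have h1 := sq_integral_le (μ := volume.restrict (Metric.ball (c : E3) h)) (g := f n)
          (hf n).integrable.restrict ((hf n).pow two_ne_zero).integrable.restrict
        rw [measureReal_restrict_apply_univ] at h1
        have h2 := (hD c (f n) (hf n)).trans (mul_le_mul_of_nonneg_left (hK n) (hD0 c).le)
        simp only [a, setAverage_eq, smul_eq_mul]
        have hvc := hv c
        calc ((v c)⁻¹ * ∫ w in Metric.ball (c : E3) h, f n w) ^ 2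
            = (v c)⁻¹ ^ 2 * (∫ w in Metric.ball (c : E3) h, f n w) ^ 2 := by ring
          _ ≤ (v c)⁻¹ ^ 2 * (v c * (D c * K)) := by gcongr; exact h1.trans (by gcongr)
          _ = _ := by field_simp
      refine (isCompact_closedBall (0 : t → ℝ) C').totallyBounded.subset ?_
      rintro _ ⟨n, rfl⟩
      rw [mem_closedBall_zero_iff, pi_norm_le_iff_of_nonneg hC']
      exact fun c => hl c n
    obtain ⟨r, hr, hrε⟩ : ∃ r : ℝ, 0 < r ∧ C * (t.card * r ^ 2) < ε ^ 2 / 2 := by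
      have hT : Tendsto (fun r : ℝ => C * (t.card * r ^ 2)) (𝓝[>] 0) (𝓝 0) := by
        have : Continuous (fun r : ℝ => C * (t.card * r ^ 2)) := by fun_prop
        simpa using (this.tendsto 0).mono_left nhdsWithin_le_nhds
      obtain ⟨r, h1, h2⟩ := ((hT.eventually (gt_mem_nhds (by positivity : 0 < ε ^ 2 / 2))).and
        self_mem_nhdsWithin).exists
      exact ⟨r, h2, h1⟩
    obtain ⟨s, hs, hsf, hcov⟩ := Metric.finite_approx_of_totallyBounded ha r hr
    have hs' : ∀ y ∈ s, ∃ n, a n = y := fun y hy => hs hy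
    choose! idx hidx using hs'
    refine ⟨(fun y => F (idx y)) '' s, hsf.image _, ?_⟩
    rintro _ ⟨n, rfl⟩
    obtain ⟨y, hy, hny⟩ := Set.mem_iUnion₂.1 (hcov ⟨n, rfl⟩)
    refine Set.mem_iUnion₂.2 ⟨_, ⟨y, hy, rfl⟩, ?_⟩
    rw [mem_ball_iff_norm]
    refine lt_of_pow_lt_pow_left₀ 2 hε.le ?_
    rw [hF]
    set m := idx y
    have hm : a m = y := hidx y hy
    have h1 := hbound _ ((hf n).sub (hf m))
    have h2 := dirichlet_sub_le (hf n) (hf m)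
    have h3 : ∑ c ∈ t, (⨍ w in Metric.ball c h, (f n w - f m w)) ^ 2 ≤ t.card * r ^ 2 := by
      rw [← nsmul_eq_mul]
      refine Finset.sum_le_card_nsmul _ _ _ fun c hc => ?_
      have e : (⨍ w in Metric.ball c h, (f n w - f m w)) = a n ⟨c, hc⟩ - a m ⟨c, hc⟩ := by
        simp only [a, setAverage_eq, smul_eq_mul]
        rw [integral_sub (hf n).integrable.restrict (hf m).integrable.restrict]; ring
      rw [e, ← sq_abs]
      have : dist (a n) (a m) < r := by rw [hm]; exact hny
      gcongr
      exact ((dist_le_pi_dist (a n) (a m) ⟨c, hc⟩).trans this.le)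
    have h4 : ε ^ 2 / (8 * (K + 1)) * dirichlet (fun x => f n x - f m x) (fun x => f n x - f m x) ≤
        ε ^ 2 / 2 := by
      calc _ ≤ ε ^ 2 / (8 * (K + 1)) * (4 * (K + 1)) := by
            gcongr
            linarith [hK n, hK m]
        _ = _ := by field_simp; norm_num
    calc _ ≤ _ := h1
      _ ≤ ε ^ 2 / 2 + C * (t.card * r ^ 2) := by gcongr
      _ < ε ^ 2 := by linarith
  obtain ⟨U, -, φ, hφ, hlim⟩ := (htb.closure.isCompact_of_isClosed isClosed_closure).tendsto_subseq
    (fun n => subset_closure ⟨n, rfl⟩ : ∀ n, F n ∈ closure (Set.range F))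
  refine ⟨φ, hφ, U, Lp.memLp U, ?_⟩
  have h1 : Tendsto (fun n => ‖F (φ n) - U‖ ^ 2) atTop (𝓝 0) := by
    have := (tendsto_iff_norm_sub_tendsto_zero.1 hlim).pow 2
    simpa using this
  refine h1.congr fun n => ?_
  have e : F (φ n) - U = (((hf (φ n)).memLp ρ).sub (Lp.memLp U)).toLp (f (φ n) - (U : E3 → ℝ)) := by
    rw [MemLp.toLp_sub _ (Lp.memLp U), Lp.toLp_coeFn]
  rw [e, norm_toLp_sq]
  rfl

/-! ### Passing to the limit in L² integrals -/

section L2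

variable {α : Type*} [MeasurableSpace α] {μ : Measure α}

lemma integrable_mul_of_memLp {f g : α → ℝ} (hf : MemLp f 2 μ) (hg : MemLp g 2 μ) :
    Integrable (fun x => f x * g x) μ :=
  hf.integrable_mul hg

lemma sq_integral_mul_le {f g : α → ℝ} (hf : MemLp f 2 μ) (hg : MemLp g 2 μ) :
    (∫ x, f x * g x ∂μ) ^ 2 ≤ (∫ x, f x ^ 2 ∂μ) * ∫ x, g x ^ 2 ∂μ := by
  have key : ∀ t : ℝ, 0 ≤ (∫ x, f x ^ 2 ∂μ) * (t * t) + (-2 * ∫ x, f x * g x ∂μ) * t +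
      ∫ x, g x ^ 2 ∂μ := fun t => by
    have h0 : 0 ≤ ∫ x, (t * f x - g x) ^ 2 ∂μ := integral_nonneg fun x => sq_nonneg _
    have : ∀ x, (t * f x - g x) ^ 2 = t ^ 2 * f x ^ 2 - 2 * t * (f x * g x) + g x ^ 2 :=
      fun x => by ring
    simp only [this] at h0
    have h3 : Integrable (fun x => t ^ 2 * f x ^ 2 - 2 * t * (f x * g x)) μ :=
      (hf.integrable_sq.const_mul _).sub ((integrable_mul_of_memLp hf hg).const_mul _)
    rw [integral_add h3 hg.integrable_sq, integral_sub (hf.integrable_sq.const_mul _)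
      ((integrable_mul_of_memLp hf hg).const_mul _), integral_const_mul, integral_const_mul] at h0
    linarith
  have := discrim_le_zero key
  unfold discrim at this
  linarith

lemma tendsto_integral_mul {f : ℕ → α → ℝ} {u w : α → ℝ} (hf : ∀ n, MemLp (f n) 2 μ)
    (hu : MemLp u 2 μ) (hw : MemLp w 2 μ)
    (h : Tendsto (fun n => ∫ x, (f n x - u x) ^ 2 ∂μ) atTop (𝓝 0)) :
    Tendsto (fun n => ∫ x, w x * f n x ∂μ) atTop (𝓝 (∫ x, w x * u x ∂μ)) := by
  rw [tendsto_iff_norm_sub_tendsto_zero]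
  have h1 : Tendsto (fun n => Real.sqrt ((∫ x, w x ^ 2 ∂μ) * ∫ x, (f n x - u x) ^ 2 ∂μ)) atTop
      (𝓝 0) := by
    simpa using (h.const_mul (∫ x, w x ^ 2 ∂μ)).sqrt
  refine squeeze_zero (fun n => norm_nonneg _) (fun n => ?_) h1
  rw [← integral_sub (integrable_mul_of_memLp hw (hf n)) (integrable_mul_of_memLp hw hu)]
  refine Real.abs_le_sqrt ?_
  have := sq_integral_mul_le hw ((hf n).sub hu)
  simpa [mul_sub] using this

lemma memLp_bdd_mul {V u : α → ℝ} {M : ℝ} (hV : Measurable V) (hM : ∀ x, |V x| ≤ M)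
    (hu : MemLp u 2 μ) : MemLp (fun x => V x * u x) 2 μ :=
  hu.of_le_mul (c := M) (hV.aestronglyMeasurable.mul hu.1) (Eventually.of_forall fun x => by
    rw [norm_mul]; exact mul_le_mul_of_nonneg_right (hM x) (norm_nonneg _))

/-- Expand V f² = V (f - u)² + 2 V u f - V u²: the first term is small because V is bounded, and the
second is a pairing with the fixed L² function V u. -/
lemma tendsto_integral_sq {f : ℕ → α → ℝ} {u V : α → ℝ} {M : ℝ} (hf : ∀ n, MemLp (f n) 2 μ)
    (hu : MemLp u 2 μ) (hV : Measurable V) (hM : ∀ x, |V x| ≤ M)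
    (h : Tendsto (fun n => ∫ x, (f n x - u x) ^ 2 ∂μ) atTop (𝓝 0)) :
    Tendsto (fun n => ∫ x, V x * f n x ^ 2 ∂μ) atTop (𝓝 (∫ x, V x * u x ^ 2 ∂μ)) := by
  have hi : ∀ {g : α → ℝ}, MemLp g 2 μ → Integrable (fun x => V x * g x ^ 2) μ := fun hg =>
    hg.integrable_sq.bdd_mul hV.aestronglyMeasurable (Eventually.of_forall hM)
  have hd : ∀ n, MemLp (fun x => f n x - u x) 2 μ := fun n => (hf n).sub hu
  have h1 : Tendsto (fun n => ∫ x, V x * (f n x - u x) ^ 2 ∂μ) atTop (𝓝 0) := by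
    have h1' : Tendsto (fun n => M * ∫ x, (f n x - u x) ^ 2 ∂μ) atTop (𝓝 0) := by
      simpa using h.const_mul M
    refine squeeze_zero_norm (fun n => ?_) h1'
    rw [← integral_const_mul]
    refine norm_integral_le_of_norm_le ((hd n).integrable_sq.const_mul M)
      (Eventually.of_forall fun x => ?_)
    rw [norm_mul, Real.norm_of_nonneg (sq_nonneg _)]
    exact mul_le_mul_of_nonneg_right (hM x) (sq_nonneg _)
  have h2 := tendsto_integral_mul hf hu (memLp_bdd_mul hV hM hu) h
  have h3 := (h1.add (h2.const_mul 2)).sub_const (∫ x, V x * u x ^ 2 ∂μ)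
  have e : 0 + 2 * ∫ x, V x * u x * u x ∂μ - ∫ x, V x * u x ^ 2 ∂μ = ∫ x, V x * u x ^ 2 ∂μ := by
    simp only [mul_assoc, ← sq]; ring
  rw [e] at h3
  refine h3.congr fun n => ?_
  rw [← integral_const_mul, ← integral_add (hi (hd n))
    ((integrable_mul_of_memLp (memLp_bdd_mul hV hM hu) (hf n)).const_mul 2), ← integral_sub]
  · congr 1; ext x; ring
  · exact (hi (hd n)).add
      ((integrable_mul_of_memLp (memLp_bdd_mul hV hM hu) (hf n)).const_mul 2)
  · exact hi hu

end L2

/-! ### Zero-energy ground states as limits of almost minimisers -/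

/-- `V` vanishes outside the ball of radius `ρ`. -/
def SuppIn (V : E3 → ℝ) (ρ : ℝ) : Prop := ∀ x, ρ < ‖x‖ → V x = 0

lemma SuppIn.integral_eq {V : E3 → ℝ} {ρ : ℝ} (hs : SuppIn V ρ) (g : E3 → ℝ) :
    ∫ x, V x * g x = ∫ x, V x * g x ∂(ballMeasure ρ) := by
  refine (setIntegral_eq_integral_of_forall_compl_eq_zero fun x hx => ?_).symm
  rw [mem_closedBall_zero_iff, not_le] at hx
  simp [hs x hx]

lemma SuppIn.potForm_self {V : E3 → ℝ} {ρ : ℝ} (hs : SuppIn V ρ) (f : E3 → ℝ) :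
    potForm V f f = ∫ x, V x * f x ^ 2 ∂(ballMeasure ρ) := by
  rw [← hs.integral_eq]
  simp [potForm, sq]

/-- `u` is the limit, in `L²` of the ball of radius `ρ`, of test functions `f n` along which the
quadratic form of `-Δ + V` tends to zero. -/
structure GroundLimit (V : E3 → ℝ) (ρ : ℝ) (f : ℕ → E3 → ℝ) (u : E3 → ℝ) : Prop where
  test : ∀ n, IsTest (f n)
  form_tendsto : Tendsto (fun n => form V (f n) (f n)) atTop (𝓝 0)
  memLp : MemLp u 2 (ballMeasure ρ)
  tendsto : Tendsto (fun n => ∫ x, (f n x - u x) ^ 2 ∂(ballMeasure ρ)) atTop (𝓝 0)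

/-- `u` is (the restriction to the ball of radius `ρ` of) a zero-energy ground state. -/
def IsGround (V : E3 → ℝ) (ρ : ℝ) (u : E3 → ℝ) : Prop := ∃ f, GroundLimit V ρ f u

variable {V : E3 → ℝ} {ρ : ℝ}

namespace GroundLimit

variable {f : ℕ → E3 → ℝ} {u : E3 → ℝ}

lemma tendsto_quad (h : GroundLimit V ρ f u) {W : E3 → ℝ} (hW : IsPotential W) (hs : SuppIn W ρ) :
    Tendsto (fun n => potForm W (f n) (f n)) atTop (𝓝 (∫ x, W x * u x ^ 2 ∂(ballMeasure ρ))) := by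
  obtain ⟨M, hM⟩ := hW.bdd
  simp only [hs.potForm_self]
  exact tendsto_integral_sq (fun n => (h.test n).memLp ρ) h.memLp hW.meas hM h.tendsto

lemma tendsto_dirichlet (h : GroundLimit V ρ f u) (hV : IsPotential V) (hs : SuppIn V ρ) :
    Tendsto (fun n => dirichlet (f n) (f n)) atTop
      (𝓝 (-∫ x, V x * u x ^ 2 ∂(ballMeasure ρ))) := by
  have := h.form_tendsto.sub (h.tendsto_quad hV hs)
  simpa [form] using this

lemma tendsto_normSq (h : GroundLimit V ρ f u) :
    Tendsto (fun n => ∫ x, f n x ^ 2 ∂(ballMeasure ρ)) atTop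
      (𝓝 (∫ x, u x ^ 2 ∂(ballMeasure ρ))) := by
  have := tendsto_integral_sq (V := fun _ => 1) (M := 1) (fun n => (h.test n).memLp ρ) h.memLp
    measurable_const (by simp) h.tendsto
  simpa using this

lemma exists_dirichlet_le (h : GroundLimit V ρ f u) (hV : IsPotential V) (hs : SuppIn V ρ) :
    ∃ K, ∀ n, dirichlet (f n) (f n) ≤ K := by
  obtain ⟨K, hK⟩ := (h.tendsto_dirichlet hV hs).bddAbove_range
  exact ⟨K, fun n => hK ⟨n, rfl⟩⟩

/-- The Dirichlet forms converge to -∫ V u², and the local Sobolev bound makes a multiple of that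
limit dominate ∫ u² > 0. -/
lemma integral_neg (h : GroundLimit V ρ f u) (hV : IsPotential V) (hs : SuppIn V ρ)
    (hu : 0 < ∫ x, u x ^ 2 ∂(ballMeasure ρ)) : ∫ x, V x * u x ^ 2 ∂(ballMeasure ρ) < 0 := by
  obtain ⟨C, hC0, hC⟩ := exists_local_const (Metric.closedBall (0 : E3) ρ)
    measure_closedBall_lt_top.ne
  have := le_of_tendsto_of_tendsto' h.tendsto_normSq ((h.tendsto_dirichlet hV hs).const_mul C)
    (fun n => hC _ (h.test n))
  by_contra! hcon
  nlinarith

/-- The form of a combination tends to zero by `FormNonneg.lin_le`, so for fixed V and ρ the ground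
states form a vector space. -/
lemma lin {g : ℕ → E3 → ℝ} {v : E3 → ℝ} (hV : IsPotential V) (hn : FormNonneg V)
    (h : GroundLimit V ρ f u) (h' : GroundLimit V ρ g v) (a b : ℝ) :
    GroundLimit V ρ (fun n x => a * f n x + b * g n x) (fun x => a * u x + b * v x) where
  test n := (h.test n).lin (h'.test n) a b
  form_tendsto := by
    have := (h.form_tendsto.const_mul (2 * a ^ 2)).add (h'.form_tendsto.const_mul (2 * b ^ 2))
    refine squeeze_zero (fun n => hn _ ((h.test n).lin (h'.test n) a b))
      (fun n => hn.lin_le hV (h.test n) (h'.test n) a b) (by simpa using this)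
  memLp := (h.memLp.const_mul a).add (h'.memLp.const_mul b)
  tendsto := by
    have := (h.tendsto.const_mul (2 * a ^ 2)).add (h'.tendsto.const_mul (2 * b ^ 2))
    refine squeeze_zero (fun n => integral_nonneg fun x => sq_nonneg _) (fun n => ?_)
      (by simpa using this)
    have i1 := (((h.test n).memLp ρ).sub h.memLp).integrable_sq.const_mul (2 * a ^ 2)
    have i2 := (((h'.test n).memLp ρ).sub h'.memLp).integrable_sq.const_mul (2 * b ^ 2)
    simp only [Pi.sub_apply] at i1 i2
    rw [← integral_const_mul, ← integral_const_mul, ← integral_add i1 i2]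
    refine integral_mono_of_nonneg (Eventually.of_forall fun x => sq_nonneg _) (i1.add i2)
      (Eventually.of_forall fun x => ?_)
    nlinarith [sq_nonneg (a * (f n x - u x) - b * (g n x - v x))]

end GroundLimit

/-- Normalised almost minimisers converge along a subsequence to a nonzero ground state. -/
theorem exists_groundLimit (hV : IsPotential V) (hs : SuppIn V ρ)
    {f : ℕ → E3 → ℝ} (hf : ∀ n, IsTest (f n)) (h1 : ∀ n, dirichlet (f n) (f n) = 1)
    (hlim : Tendsto (fun n => form V (f n) (f n)) atTop (𝓝 0)) :
    ∃ φ : ℕ → ℕ, StrictMono φ ∧ ∃ u, GroundLimit V ρ (fun n => f (φ n)) u ∧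
      ∫ x, V x * u x ^ 2 ∂(ballMeasure ρ) = -1 := by
  obtain ⟨φ, hφ, u, hu, hconv⟩ := exists_subseq_tendsto ρ hf (fun n => (h1 n).le)
  have hG : GroundLimit V ρ (fun n => f (φ n)) u :=
    ⟨fun n => hf _, hlim.comp hφ.tendsto_atTop, hu, hconv⟩
  refine ⟨φ, hφ, u, hG, ?_⟩
  have h2 := hG.tendsto_dirichlet hV hs
  simp only [h1] at h2
  have := tendsto_nhds_unique h2 tendsto_const_nhds
  linarith

lemma integral_sq_pos_of_integral_ne {u W : E3 → ℝ}
    (hu : MemLp u 2 (ballMeasure ρ))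
    (h : ∫ x, W x * u x ^ 2 ∂(ballMeasure ρ) ≠ 0) : 0 < ∫ x, u x ^ 2 ∂(ballMeasure ρ) := by
  refine (integral_nonneg fun x => sq_nonneg _).lt_of_ne fun h0 => h ?_
  have h1 := (integral_eq_zero_iff_of_nonneg (fun x => sq_nonneg _) hu.integrable_sq).1 h0.symm
  refine integral_eq_zero_of_ae ?_
  filter_upwards [h1] with x hx
  simp only [Pi.zero_apply] at hx ⊢
  rw [hx, mul_zero]

/-- With zero Dirichlet form, f vanishes almost everywhere on the ball carrying W, so the potential
term would vanish too. -/
lemma dirichlet_pos_of_form_neg {W f : E3 → ℝ} (hs : SuppIn W ρ) (hf : IsTest f)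
    (h : form W f f < 0) : 0 < dirichlet f f := by
  refine (dirichlet_self_nonneg f).lt_of_ne fun h0 => ?_
  obtain ⟨C, hC0, hC⟩ := exists_local_const (Metric.closedBall (0 : E3) ρ)
    measure_closedBall_lt_top.ne
  have h2 : ∫ x, f x ^ 2 ∂(ballMeasure ρ) ≤ 0 := by
    have := hC f hf
    rwa [← h0, mul_zero] at this
  refine absurd (integral_sq_pos_of_integral_ne (W := W) (hf.memLp ρ) ?_) (not_lt.2 h2)
  rw [← hs.potForm_self]
  unfold form at h
  intro h3
  rw [h3, ← h0] at h
  simp at h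

/-- A potential whose form takes a negative value has a normalised test function witnessing it. -/
lemma exists_normalized {W : E3 → ℝ} (hs : SuppIn W ρ) (h : ¬ FormNonneg W) :
    ∃ f, IsTest f ∧ dirichlet f f = 1 ∧ form W f f < 0 := by
  unfold FormNonneg at h
  push Not at h
  obtain ⟨f, hf, hneg⟩ := h
  have hpos := dirichlet_pos_of_form_neg hs hf hneg
  set a := (Real.sqrt (dirichlet f f))⁻¹
  have ha : a ^ 2 = (dirichlet f f)⁻¹ := by
    rw [inv_pow, Real.sq_sqrt hpos.le]
  refine ⟨fun x => a * f x, hf.const_mul a, ?_, ?_⟩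
  · rw [dirichlet_const_mul, ha, inv_mul_cancel₀ hpos.ne']
  · rw [form_const_mul, ha]
    exact mul_neg_of_pos_of_neg (inv_pos.2 hpos) hneg

/-- The potential form is bounded on normalised test functions. -/
lemma exists_potForm_le {W : E3 → ℝ} (hW : IsPotential W) (hs : SuppIn W ρ) :
    ∃ C, 0 ≤ C ∧ ∀ f, IsTest f → |potForm W f f| ≤ C * dirichlet f f := by
  obtain ⟨C, hC0, hC⟩ := exists_local_const (Metric.closedBall (0 : E3) ρ)
    measure_closedBall_lt_top.ne
  obtain ⟨M, hM⟩ := hW.bdd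
  have hM0 : 0 ≤ M := (abs_nonneg _).trans (hM 0)
  refine ⟨M * C, by positivity, fun f hf => ?_⟩
  rw [hs.potForm_self]
  calc |∫ x, W x * f x ^ 2 ∂(ballMeasure ρ)| ≤ ∫ x, M * f x ^ 2 ∂(ballMeasure ρ) := by
        rw [← Real.norm_eq_abs]
        refine norm_integral_le_of_norm_le ((hf.memLp ρ).integrable_sq.const_mul M)
          (Eventually.of_forall fun x => ?_)
        rw [norm_mul, Real.norm_of_nonneg (sq_nonneg _)]
        exact mul_le_mul_of_nonneg_right (hM x) (sq_nonneg _)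
    _ ≤ M * C * dirichlet f f := by
        rw [integral_const_mul, mul_assoc]
        exact mul_le_mul_of_nonneg_left (hC f hf) hM0

/-! ### Absolute values of ground states -/

lemma dirichlet_comp_le {f : E3 → ℝ} {θ : ℝ → ℝ} {θ' : E3 → ℝ} {L : ℝ} (hf : IsTest f)
    (hθ : ∀ x, HasDerivAt θ (θ' x) (f x)) (hL : ∀ x, θ' x ^ 2 ≤ L) :
    dirichlet (fun x => θ (f x)) (fun x => θ (f x)) ≤ L * dirichlet f f := by
  unfold dirichlet
  rw [← integral_const_mul]
  refine integral_mono_of_nonneg (Eventually.of_forall (gdot_self_nonneg _))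
    ((hf.integrable_gdot hf).const_mul L) (Eventually.of_forall fun x => ?_)
  simp only
  rw [gdot_comp_self (hf.differentiable x) (hθ x)]
  exact mul_le_mul_of_nonneg_right (hL x) (gdot_self_nonneg f x)

/-- A smooth approximation of the absolute value, vanishing at `0`. -/
def smoothAbs (ε t : ℝ) : ℝ := Real.sqrt (t ^ 2 + ε ^ 2) - ε

section smoothAbs

variable {ε : ℝ}

lemma smoothAbs_nonneg (ε t : ℝ) : 0 ≤ smoothAbs ε t := by
  have : ε ≤ Real.sqrt (t ^ 2 + ε ^ 2) := Real.le_sqrt_of_sq_le (by nlinarith [sq_nonneg t])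
  unfold smoothAbs; linarith

lemma abs_smoothAbs_sub_le (hε : 0 < ε) (t : ℝ) : |smoothAbs ε t - (|t|)| ≤ ε := by
  have h1 : |t| ≤ Real.sqrt (t ^ 2 + ε ^ 2) :=
    Real.abs_le_sqrt (by nlinarith [sq_nonneg ε])
  have h2 : Real.sqrt (t ^ 2 + ε ^ 2) ≤ |t| + ε := by
    rw [Real.sqrt_le_left (by positivity)]
    nlinarith [abs_nonneg t, sq_abs t, mul_nonneg (abs_nonneg t) hε.le]
  unfold smoothAbs
  rw [abs_le]; constructor <;> linarith

lemma hasDerivAt_smoothAbs (hε : 0 < ε) (t : ℝ) :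
    HasDerivAt (smoothAbs ε) (t / Real.sqrt (t ^ 2 + ε ^ 2)) t := by
  have h0 : t ^ 2 + ε ^ 2 ≠ 0 := by positivity
  have h1 : HasDerivAt (fun t : ℝ => t ^ 2 + ε ^ 2) (2 * t) t := by
    simpa using (hasDerivAt_pow 2 t).add_const (ε ^ 2)
  have h2 := (h1.sqrt h0).sub_const ε
  have e : t / Real.sqrt (t ^ 2 + ε ^ 2) = 2 * t / (2 * Real.sqrt (t ^ 2 + ε ^ 2)) := by
    field_simp
  rw [e]
  exact h2

lemma contDiff_smoothAbs (hε : 0 < ε) : ContDiff ℝ ∞ (smoothAbs ε) :=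
  (ContDiff.sqrt (by fun_prop) fun t => by positivity).sub contDiff_const

lemma IsTest.smoothAbs {f : E3 → ℝ} (hf : IsTest f) (hε : 0 < ε) :
    IsTest (fun x => smoothAbs ε (f x)) where
  smooth := (contDiff_smoothAbs hε).comp hf.smooth
  supp := hf.supp.comp_left (g := CriticalCoupling.smoothAbs ε)
    (by simp [CriticalCoupling.smoothAbs, Real.sqrt_sq hε.le])

lemma dirichlet_smoothAbs_le {f : E3 → ℝ} (hf : IsTest f) (hε : 0 < ε) :
    dirichlet (fun x => smoothAbs ε (f x)) (fun x => smoothAbs ε (f x)) ≤ dirichlet f f := by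
  have := dirichlet_comp_le (L := 1) hf (fun x => hasDerivAt_smoothAbs hε (f x)) fun x => by
    rw [div_pow, Real.sq_sqrt (by positivity)]
    exact div_le_one_of_le₀ (by nlinarith [sq_nonneg ε]) (by positivity)
  simpa using this

end smoothAbs

/-- The absolute value of a ground state is a ground state, with nonnegative approximants. -/
theorem GroundLimit.exists_abs {f : ℕ → E3 → ℝ} {u : E3 → ℝ} (hV : IsPotential V)
    (hs : SuppIn V ρ) (hn : FormNonneg V) (h : GroundLimit V ρ f u) :
    ∃ g, GroundLimit V ρ g (fun x => |u x|) ∧ ∀ n x, 0 ≤ g n x := by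
  set e : ℕ → ℝ := fun n => 1 / ((n : ℝ) + 1)
  have he : ∀ n, 0 < e n := fun n => by positivity
  have he0 : Tendsto e atTop (𝓝 0) := tendsto_one_div_add_atTop_nhds_zero_nat
  set g : ℕ → E3 → ℝ := fun n x => smoothAbs (e n) (f n x)
  have hg : ∀ n, IsTest (g n) := fun n => (h.test n).smoothAbs (he n)
  have hu : MemLp (fun x => |u x|) 2 (ballMeasure ρ) := h.memLp.abs
  have hconv : Tendsto (fun n => ∫ x, (g n x - |u x|) ^ 2 ∂(ballMeasure ρ)) atTop (𝓝 0) := by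
    have h1 : Tendsto (fun n => 2 * e n ^ 2 * (ballMeasure ρ).real Set.univ +
        2 * ∫ x, (f n x - u x) ^ 2 ∂(ballMeasure ρ)) atTop (𝓝 0) := by
      have := (((he0.pow 2).const_mul 2).mul_const ((ballMeasure ρ).real Set.univ)).add
        (h.tendsto.const_mul 2)
      simpa using this
    refine squeeze_zero (fun n => integral_nonneg fun x => sq_nonneg _) (fun n => ?_) h1
    have i1 := (((h.test n).memLp ρ).sub h.memLp).integrable_sq.const_mul 2
    simp only [Pi.sub_apply] at i1
    have e1 : 2 * e n ^ 2 * (ballMeasure ρ).real Set.univ = ∫ _, 2 * e n ^ 2 ∂(ballMeasure ρ) := by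
      simp [mul_comm]
    rw [e1, ← integral_const_mul, ← integral_add (integrable_const _) i1]
    refine integral_mono_of_nonneg (Eventually.of_forall fun x => sq_nonneg _)
      ((integrable_const _).add i1) (Eventually.of_forall fun x => ?_)
    have h2 : |g n x - (|u x|)| ≤ e n + |f n x - u x| := by
      have := abs_smoothAbs_sub_le (he n) (f n x)
      calc |g n x - (|u x|)| = |(g n x - |f n x|) + (|f n x| - |u x|)| := by ring_nf
        _ ≤ |g n x - (|f n x|)| + |(|f n x| - |u x|)| := abs_add_le _ _
        _ ≤ _ := add_le_add this (abs_abs_sub_abs_le _ _)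
    have h3 : (g n x - |u x|) ^ 2 ≤ (e n + |f n x - u x|) ^ 2 := sq_le_sq' (by
      linarith [neg_abs_le (g n x - |u x|)]) ((le_abs_self _).trans h2)
    have h4 := sq_abs (f n x - u x)
    simp only
    nlinarith [sq_nonneg (e n - |f n x - u x|)]
  refine ⟨g, ⟨hg, ?_, hu, hconv⟩, fun n x => smoothAbs_nonneg _ _⟩
  have hq : Tendsto (fun n => potForm V (g n) (g n)) atTop
      (𝓝 (∫ x, V x * u x ^ 2 ∂(ballMeasure ρ))) := by
    obtain ⟨M, hM⟩ := hV.bdd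
    simp only [hs.potForm_self]
    have := tendsto_integral_sq (fun n => (hg n).memLp ρ) hu hV.meas hM hconv
    simpa [sq_abs] using this
  -- Replacing f by its smoothed absolute value does not increase the Dirichlet form, and both
  -- potential terms have the same limit. The forms of g are thus squeezed between zero and a null
  -- sequence.
  have hub : Tendsto (fun n => form V (f n) (f n) - potForm V (f n) (f n) +
      potForm V (g n) (g n)) atTop (𝓝 0) := by
    simpa using (h.form_tendsto.sub (h.tendsto_quad hV hs)).add hq
  refine squeeze_zero (fun n => hn _ (hg n)) (fun n => ?_) hub
  have := dirichlet_smoothAbs_le (h.test n) (he n)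
  simp only [form]
  linarith

/-! ### Logarithmic estimates for nonnegative almost minimisers -/

/-- The test function `ζ² / (f + ε)`. -/
def logTest (ζ f : E3 → ℝ) (ε : ℝ) (x : E3) : ℝ := ζ x ^ 2 * (f x + ε)⁻¹

lemma IsTest.logTest {ζ f : E3 → ℝ} {ε : ℝ} (hζ : IsTest ζ) (hf : IsTest f) (hf0 : ∀ x, 0 ≤ f x)
    (hε : 0 < ε) : IsTest (logTest ζ f ε) :=
  (hζ.pow two_ne_zero).mul_smooth
    ((hf.smooth.add contDiff_const).inv fun x => by have := hf0 x; positivity)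

lemma pd_logTest {ζ f : E3 → ℝ} {ε : ℝ} (hζ : IsTest ζ) (hf : IsTest f) (hf0 : ∀ x, 0 ≤ f x)
    (hε : 0 < ε) (i : Fin 3) (x : E3) :
    pd i (logTest ζ f ε) x = 2 * (ζ x * (f x + ε)⁻¹) * pd i ζ x -
      (ζ x * (f x + ε)⁻¹) ^ 2 * pd i f x := by
  have hne : f x + ε ≠ 0 := by have := hf0 x; positivity
  have h1 : DifferentiableAt ℝ (fun x => (f x + ε)⁻¹) x :=
    ((hf.differentiable x).add_const ε).inv hne
  have h2 := pd_comp (θ := fun t => t ^ 2) (θ' := 2 * ζ x) (hζ.differentiable x)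
    (by simpa using hasDerivAt_pow 2 (ζ x)) i
  have h3 := pd_comp (θ := fun t => (t + ε)⁻¹) (θ' := -1 / (f x + ε) ^ 2) (hf.differentiable x)
    (((hasDerivAt_id (f x)).add_const ε).inv hne) i
  have h4 := pd_mul (f := fun x => ζ x ^ 2) (g := fun x => (f x + ε)⁻¹)
    (((hζ.pow two_ne_zero).differentiable) x) h1 i
  rw [h2, h3] at h4
  unfold logTest
  rw [h4]
  field_simp
  ring

lemma gdot_logTest {ζ f : E3 → ℝ} {ε : ℝ} (hζ : IsTest ζ) (hf : IsTest f) (hf0 : ∀ x, 0 ≤ f x)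
    (hε : 0 < ε) (x : E3) :
    gdot f (logTest ζ f ε) x = 2 * (ζ x * (f x + ε)⁻¹) * gdot f ζ x -
      (ζ x * (f x + ε)⁻¹) ^ 2 * gdot f f x := by
  simp only [gdot, pd_logTest hζ hf hf0 hε, Fin.sum_univ_three]; ring

/-- Young's inequality on the cross term, from the square of a∇f - 2∇ζ with a = ζ/(f+ε). Half of the
good term a²|∇f|² survives, with no ε in the coefficients. -/
lemma gdot_logTest_le {ζ f : E3 → ℝ} {ε : ℝ} (hζ : IsTest ζ) (hf : IsTest f)
    (hf0 : ∀ x, 0 ≤ f x) (hε : 0 < ε) (x : E3) :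
    gdot f (logTest ζ f ε) x ≤
      2 * gdot ζ ζ x - 1 / 2 * ((ζ x * (f x + ε)⁻¹) ^ 2 * gdot f f x) := by
  rw [gdot_logTest hζ hf hf0 hε]
  set a := ζ x * (f x + ε)⁻¹
  have : 0 ≤ ∑ i, (a * pd i f x - 2 * pd i ζ x) ^ 2 := Finset.sum_nonneg fun _ _ => sq_nonneg _
  simp only [gdot, Fin.sum_univ_three] at this ⊢
  nlinarith

/-- This bound degenerates as ε → 0. It only serves to keep the form of `logTest` bounded in n at
fixed ε, as `FormNonneg.tendsto_zero` requires. -/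
lemma gdot_logTest_self_le {ζ f : E3 → ℝ} {ε : ℝ} (hζ : IsTest ζ) (hζ1 : ∀ x, |ζ x| ≤ 1)
    (hf : IsTest f) (hf0 : ∀ x, 0 ≤ f x) (hε : 0 < ε) (x : E3) :
    gdot (logTest ζ f ε) (logTest ζ f ε) x ≤
      8 * (ε⁻¹) ^ 2 * gdot ζ ζ x + 2 * (ε⁻¹) ^ 4 * gdot f f x := by
  set a := ζ x * (f x + ε)⁻¹
  have ha : |a| ≤ ε⁻¹ := by
    have h1 : (f x + ε)⁻¹ ≤ ε⁻¹ := by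
      gcongr; linarith [hf0 x]
    have h2 : 0 ≤ (f x + ε)⁻¹ := by have := hf0 x; positivity
    calc |a| = |ζ x| * (f x + ε)⁻¹ := by rw [abs_mul, abs_of_nonneg h2]
      _ ≤ 1 * ε⁻¹ := by gcongr; exact hζ1 x
      _ = _ := one_mul _
  have ha2 : a ^ 2 ≤ (ε⁻¹) ^ 2 := by rw [← sq_abs]; gcongr
  have ha4 : a ^ 4 ≤ (ε⁻¹) ^ 4 := by
    calc a ^ 4 = (a ^ 2) ^ 2 := by ring
      _ ≤ ((ε⁻¹) ^ 2) ^ 2 := by gcongr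
      _ = _ := by ring
  have h1 : gdot (logTest ζ f ε) (logTest ζ f ε) x ≤
      8 * a ^ 2 * gdot ζ ζ x + 2 * a ^ 4 * gdot f f x := by
    have : 0 ≤ ∑ i, (2 * a * pd i ζ x + a ^ 2 * pd i f x) ^ 2 :=
      Finset.sum_nonneg fun _ _ => sq_nonneg _
    simp only [gdot, pd_logTest hζ hf hf0 hε, Fin.sum_univ_three] at this ⊢
    change (2 * a * _ - a ^ 2 * _) * (2 * a * _ - a ^ 2 * _) +
      (2 * a * _ - a ^ 2 * _) * (2 * a * _ - a ^ 2 * _) +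
      (2 * a * _ - a ^ 2 * _) * (2 * a * _ - a ^ 2 * _) ≤ _
    nlinarith
  have := gdot_self_nonneg ζ x
  have := gdot_self_nonneg f x
  exact h1.trans (by gcongr)

/-- A bound on the logarithmic gradient of almost minimisers that does not depend on the
regularisation `ε`. -/
lemma exists_log_gradient_bound (hV : IsPotential V) (hn : FormNonneg V) {f : ℕ → E3 → ℝ}
    (hf : ∀ n, IsTest (f n)) (hf0 : ∀ n x, 0 ≤ f n x)
    (hlim : Tendsto (fun n => form V (f n) (f n)) atTop (𝓝 0)) {K : ℝ}
    (hK : ∀ n, dirichlet (f n) (f n) ≤ K) {ζ : E3 → ℝ} (hζ : IsTest ζ) (hζ1 : ∀ x, |ζ x| ≤ 1) :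
    ∃ C, ∀ ε, 0 < ε → ∀ᶠ n in atTop,
      ∫ x, (ζ x * (f n x + ε)⁻¹) ^ 2 * gdot (f n) (f n) x ≤ C := by
  obtain ⟨M, hM⟩ := hV.bdd
  have hM0 : 0 ≤ M := (abs_nonneg _).trans (hM 0)
  -- Eventually -1 < form V f (ζ²/(f+ε)) ≤ 2 dirichlet ζ ζ - ½∫w + M∫ζ², where w = ζ²|∇f|²/(f+ε)²;
  -- solving for ∫w gives this constant. Only the threshold in n depends on ε.
  refine ⟨4 * dirichlet ζ ζ + 2 * M * (∫ x, ζ x ^ 2) + 2, fun ε hε => ?_⟩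
  have ht : ∀ n, IsTest (logTest ζ (f n) ε) := fun n => hζ.logTest (hf n) (hf0 n) hε
  have hbd : ∀ n, form V (logTest ζ (f n) ε) (logTest ζ (f n) ε) ≤
      8 * (ε⁻¹) ^ 2 * dirichlet ζ ζ + 2 * (ε⁻¹) ^ 4 * K + M * (ε⁻¹) ^ 2 * ∫ x, ζ x ^ 2 := by
    intro n
    have h1 : dirichlet (logTest ζ (f n) ε) (logTest ζ (f n) ε) ≤
        8 * (ε⁻¹) ^ 2 * dirichlet ζ ζ + 2 * (ε⁻¹) ^ 4 * K := by
      calc _ ≤ ∫ x, (8 * (ε⁻¹) ^ 2 * gdot ζ ζ x + 2 * (ε⁻¹) ^ 4 * gdot (f n) (f n) x) :=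
            integral_mono ((ht n).integrable_gdot (ht n))
              (((hζ.integrable_gdot hζ).const_mul _).add
                (((hf n).integrable_gdot (hf n)).const_mul _))
              (gdot_logTest_self_le hζ hζ1 (hf n) (hf0 n) hε)
        _ = 8 * (ε⁻¹) ^ 2 * dirichlet ζ ζ + 2 * (ε⁻¹) ^ 4 * dirichlet (f n) (f n) := by
            rw [integral_add ((hζ.integrable_gdot hζ).const_mul _)
                (((hf n).integrable_gdot (hf n)).const_mul _),
              integral_const_mul, integral_const_mul]
            rfl
        _ ≤ _ := by gcongr; exact hK n
    have h2 : potForm V (logTest ζ (f n) ε) (logTest ζ (f n) ε) ≤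
        M * (ε⁻¹) ^ 2 * ∫ x, ζ x ^ 2 := by
      unfold potForm
      rw [← integral_const_mul]
      refine integral_mono ((ht n).integrable_pot hV (ht n))
        ((hζ.pow two_ne_zero).integrable.const_mul _) fun x => ?_
      have h3 : 0 ≤ (f n x + ε)⁻¹ := by have := hf0 n x; positivity
      have h4 : (f n x + ε)⁻¹ ≤ ε⁻¹ := by gcongr; linarith [hf0 n x]
      have h5 : ζ x ^ 2 ≤ 1 := by rw [← sq_abs]; exact pow_le_one₀ (abs_nonneg _) (hζ1 x)
      have h6 : logTest ζ (f n) ε x * logTest ζ (f n) ε x ≤ (ε⁻¹) ^ 2 * ζ x ^ 2 := by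
        unfold logTest
        calc _ = (ζ x ^ 2) * ((f n x + ε)⁻¹) ^ 2 * ζ x ^ 2 := by ring
          _ ≤ 1 * (ε⁻¹) ^ 2 * ζ x ^ 2 := by gcongr
          _ = _ := by ring
      have h7 : 0 ≤ logTest ζ (f n) ε x * logTest ζ (f n) ε x := mul_self_nonneg _
      calc _ ≤ M * (logTest ζ (f n) ε x * logTest ζ (f n) ε x) :=
            mul_le_mul_of_nonneg_right ((le_abs_self _).trans (hM x)) h7
        _ ≤ M * ((ε⁻¹) ^ 2 * ζ x ^ 2) := by gcongr
        _ = _ := by ring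
    unfold form
    linarith
  have hT := hn.tendsto_zero hV hf ht hlim hbd
  filter_upwards [hT.eventually (lt_mem_nhds (by norm_num : (-1 : ℝ) < 0))] with n hn1
  set w : E3 → ℝ := fun x => (ζ x * (f n x + ε)⁻¹) ^ 2 * gdot (f n) (f n) x
  have hw : Integrable w := by
    have hc : Continuous w := by
      refine Continuous.mul (Continuous.pow (hζ.continuous.mul ?_) 2)
        ((hf n).continuous_gdot (hf n))
      exact ((hf n).continuous.add continuous_const).inv₀ fun x =>
        (add_pos_of_nonneg_of_pos (hf0 n x) hε).ne'
    exact hc.integrable_of_hasCompactSupport ((hf n).supp_gdot.mul_left)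
  have h1 : dirichlet (f n) (logTest ζ (f n) ε) ≤ 2 * dirichlet ζ ζ - 1 / 2 * ∫ x, w x := by
    unfold dirichlet
    rw [← integral_const_mul, ← integral_const_mul,
      ← integral_sub ((hζ.integrable_gdot hζ).const_mul _) (hw.const_mul _)]
    exact integral_mono ((hf n).integrable_gdot (ht n))
      (((hζ.integrable_gdot hζ).const_mul _).sub (hw.const_mul _))
      (gdot_logTest_le hζ (hf n) (hf0 n) hε)
  have h2 : potForm V (f n) (logTest ζ (f n) ε) ≤ M * ∫ x, ζ x ^ 2 := by
    unfold potForm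
    rw [← integral_const_mul]
    refine integral_mono ((hf n).integrable_pot hV (ht n))
      ((hζ.pow two_ne_zero).integrable.const_mul _) fun x => ?_
    have h0 := hf0 n x
    have h3 : 0 ≤ f n x * (f n x + ε)⁻¹ := by positivity
    have h4 : f n x * (f n x + ε)⁻¹ ≤ 1 := by
      rw [← div_eq_mul_inv]; exact div_le_one_of_le₀ (by linarith) (by positivity)
    calc V x * (f n x * logTest ζ (f n) ε x) = V x * (f n x * (f n x + ε)⁻¹ * ζ x ^ 2) := by
          unfold logTest; ring
      _ ≤ M * (f n x * (f n x + ε)⁻¹ * ζ x ^ 2) :=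
          mul_le_mul_of_nonneg_right ((le_abs_self _).trans (hM x)) (by positivity)
      _ ≤ M * (1 * ζ x ^ 2) := by gcongr
      _ = _ := by ring
  unfold form at hn1
  linarith

/-- A Poincaré-type inequality for the double integral of squared differences over a ball. -/
lemma lintegral_lintegral_sq_sub_le {w : E3 → ℝ} (hw : ContDiff ℝ 1 w) :
    ∫⁻ x, ∫⁻ y, ENNReal.ofReal ((w y - w x) ^ 2) ∂(ballMeasure ρ) ∂(ballMeasure ρ) ≤
      volume (Metric.closedBall (0 : E3) (2 * ρ)) * (ENNReal.ofReal ((2 * ρ) ^ 2) *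
        ∫⁻ x in Metric.closedBall (0 : E3) (3 * ρ), ENNReal.ofReal (‖fderiv ℝ w x‖ ^ 2)) := by
  have hcont : Continuous w := hw.continuous
  have hmeas : Measurable (Function.uncurry fun x z : E3 =>
      ENNReal.ofReal ((w (x + z) - w x) ^ 2)) :=
    (by fun_prop : Continuous fun p : E3 × E3 => (w (p.1 + p.2) - w p.1) ^ 2).measurable.ennreal_ofReal
  calc _ ≤ ∫⁻ x in Metric.closedBall (0 : E3) ρ, ∫⁻ z in Metric.closedBall (0 : E3) (2 * ρ),
          ENNReal.ofReal ((w (x + z) - w x) ^ 2) := by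
        refine setLIntegral_mono' measurableSet_closedBall fun x hx => ?_
        rw [← lintegral_indicator measurableSet_closedBall,
          ← lintegral_indicator measurableSet_closedBall,
          ← lintegral_add_left_eq_self ((Metric.closedBall (0 : E3) ρ).indicator
            fun y => ENNReal.ofReal ((w y - w x) ^ 2)) x]
        refine lintegral_mono fun z => ?_
        by_cases hz : x + z ∈ Metric.closedBall (0 : E3) ρ
        · have hz2 : z ∈ Metric.closedBall (0 : E3) (2 * ρ) := by
            rw [mem_closedBall_zero_iff] at *
            calc ‖z‖ = ‖(x + z) - x‖ := by simp
              _ ≤ ‖x + z‖ + ‖x‖ := norm_sub_le _ _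
              _ ≤ _ := by linarith
          rw [Set.indicator_of_mem hz, Set.indicator_of_mem hz2]
        · rw [Set.indicator_of_notMem hz]; exact zero_le
    _ = ∫⁻ z in Metric.closedBall (0 : E3) (2 * ρ), ∫⁻ x in Metric.closedBall (0 : E3) ρ,
          ENNReal.ofReal ((w (x + z) - w x) ^ 2) := lintegral_lintegral_swap hmeas.aemeasurable
    _ ≤ ∫⁻ z in Metric.closedBall (0 : E3) (2 * ρ), ENNReal.ofReal ((2 * ρ) ^ 2) *
          ∫⁻ x in Metric.closedBall (0 : E3) (3 * ρ), ENNReal.ofReal (‖fderiv ℝ w x‖ ^ 2) := by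
        refine setLIntegral_mono measurable_const fun z hz => ?_
        rw [mem_closedBall_zero_iff] at hz
        refine (lintegral_sq_sub_translate_le hw measurableSet_closedBall
          (measurableSet_closedBall (x := (0 : E3)) (ε := 3 * ρ)) z fun x hx t ht => ?_).trans ?_
        · rw [mem_closedBall_zero_iff] at *
          calc ‖x + t • z‖ ≤ ‖x‖ + ‖t • z‖ := norm_add_le _ _
            _ ≤ ρ + 1 * (2 * ρ) := by
                rw [norm_smul, Real.norm_of_nonneg ht.1.le]
                gcongr
                exact ht.2
            _ = 3 * ρ := by ring
        · gcongr
    _ = _ := by rw [setLIntegral_const, mul_comm]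

/-- A smooth cutoff function equal to `1` on the ball of radius `r`. -/
lemma exists_cutoff {r R : ℝ} (hr : 0 < r) (hR : r < R) :
    ∃ ζ : E3 → ℝ, IsTest ζ ∧ (∀ x, 0 ≤ ζ x) ∧ (∀ x, ζ x ≤ 1) ∧ (∀ x, ‖x‖ ≤ r → ζ x = 1) ∧
      ∀ x, R ≤ ‖x‖ → ζ x = 0 := by
  let b : ContDiffBump (0 : E3) := ⟨r, R, hr, hR⟩
  refine ⟨b, ⟨b.contDiff, b.hasCompactSupport⟩, fun x => b.nonneg, fun x => b.le_one,
    fun x hx => b.one_of_mem_closedBall (by simpa using hx), fun x hx =>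
      b.zero_of_le_dist (by simpa using hx)⟩

/-- The double integral of squared differences of `log (f n + ε)` is bounded independently of `ε`
along almost minimisers. -/
lemma exists_log_oscillation_bound (hV : IsPotential V) (hn : FormNonneg V) {f : ℕ → E3 → ℝ}
    (hf : ∀ n, IsTest (f n)) (hf0 : ∀ n x, 0 ≤ f n x)
    (hlim : Tendsto (fun n => form V (f n) (f n)) atTop (𝓝 0)) {K : ℝ}
    (hK : ∀ n, dirichlet (f n) (f n) ≤ K) (hρ : 0 < ρ) :
    ∃ C : ENNReal, C ≠ ⊤ ∧ ∀ ε, 0 < ε → ∀ᶠ n in atTop,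
      ∫⁻ x, ∫⁻ y, ENNReal.ofReal ((Real.log (f n y + ε) - Real.log (f n x + ε)) ^ 2)
        ∂(ballMeasure ρ) ∂(ballMeasure ρ) ≤ C := by
  -- Segments x + t z with |x| ≤ ρ and |z| ≤ 2ρ stay in the ball of radius 3ρ, where the cutoff must
  -- equal 1.
  obtain ⟨ζ, hζ, hζ0, hζ1, hζr, -⟩ := exists_cutoff (r := 3 * ρ) (R := 4 * ρ) (by positivity)
    (by linarith)
  obtain ⟨C, hC⟩ := exists_log_gradient_bound hV hn hf hf0 hlim hK hζ
    (fun x => abs_le.2 ⟨by linarith [hζ0 x], hζ1 x⟩)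
  refine ⟨volume (Metric.closedBall (0 : E3) (2 * ρ)) * (ENNReal.ofReal ((2 * ρ) ^ 2) *
    ENNReal.ofReal C), ?_, fun ε hε => ?_⟩
  · exact ENNReal.mul_ne_top measure_closedBall_lt_top.ne
      (ENNReal.mul_ne_top ENNReal.ofReal_ne_top ENNReal.ofReal_ne_top)
  filter_upwards [hC ε hε] with n hCn
  have hpos : ∀ x, 0 < f n x + ε := fun x => add_pos_of_nonneg_of_pos (hf0 n x) hε
  have hw : ContDiff ℝ 1 (fun x => Real.log (f n x + ε)) :=
    (((hf n).smooth.add contDiff_const).log fun x => (hpos x).ne').of_le (by simp)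
  refine (lintegral_lintegral_sq_sub_le hw).trans ?_
  gcongr
  set w : E3 → ℝ := fun x => (ζ x * (f n x + ε)⁻¹) ^ 2 * gdot (f n) (f n) x
  have hwc : Continuous w := by
    refine Continuous.mul (Continuous.pow (hζ.continuous.mul ?_) 2)
      ((hf n).continuous_gdot (hf n))
    exact ((hf n).continuous.add continuous_const).inv₀ fun x => (hpos x).ne'
  have hwi : Integrable w := hwc.integrable_of_hasCompactSupport ((hf n).supp_gdot.mul_left)
  calc _ ≤ ∫⁻ x in Metric.closedBall (0 : E3) (3 * ρ), ENNReal.ofReal (w x) := by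
        refine setLIntegral_mono' measurableSet_closedBall fun x hx => ?_
        refine ENNReal.ofReal_le_ofReal ((norm_fderiv_sq_le _ _).trans ?_)
        have hd : HasDerivAt (fun t => Real.log (t + ε)) ((f n x + ε)⁻¹) (f n x) := by
          simpa using ((hasDerivAt_id (f n x)).add_const ε).log (hpos x).ne'
        rw [gdot_comp_self ((hf n).differentiable x) hd]
        simp [w, hζr x (by simpa using hx)]
    _ ≤ ∫⁻ x, ENNReal.ofReal (w x) := setLIntegral_le_lintegral _ _
    _ = ENNReal.ofReal (∫ x, w x) := (ofReal_integral_eq_lintegral_ofReal hwi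
        (Eventually.of_forall fun x => mul_nonneg (sq_nonneg _) (gdot_self_nonneg _ _))).symm
    _ ≤ ENNReal.ofReal C := ENNReal.ofReal_le_ofReal hCn

/-! ### Nonvanishing, constant sign and uniqueness of ground states -/

lemma GroundLimit.exists_subseq_ae {f : ℕ → E3 → ℝ} {u : E3 → ℝ} (h : GroundLimit V ρ f u) :
    ∃ φ : ℕ → ℕ, StrictMono φ ∧
      ∀ᵐ x ∂(ballMeasure ρ), Tendsto (fun n => f (φ n) x) atTop (𝓝 (u x)) := by
  refine TendstoInMeasure.exists_seq_tendsto_ae (f := f) (g := u) (μ := ballMeasure ρ) ?_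
  refine tendstoInMeasure_of_tendsto_eLpNorm (p := 2) (by norm_num)
    (fun n => ((h.test n).memLp ρ).1) h.memLp.1 ?_
  have hm : ∀ n, MemLp (f n - u) 2 (ballMeasure ρ) := fun n => ((h.test n).memLp ρ).sub h.memLp
  have h1 : ∀ n, eLpNorm (f n - u) 2 (ballMeasure ρ) =
      ENNReal.ofReal (Real.sqrt (∫ x, (f n x - u x) ^ 2 ∂(ballMeasure ρ))) := fun n => by
    rw [← ENNReal.ofReal_toReal (hm n).2.ne, ← Lp.norm_toLp (f n - u) (hm n)]
    congr 1
    rw [eq_comm, Real.sqrt_eq_iff_eq_sq (integral_nonneg fun x => sq_nonneg _) (norm_nonneg _),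
      norm_toLp_sq]
    rfl
  simp only [h1]
  simpa using ENNReal.tendsto_ofReal h.tendsto.sqrt

/-- A nonnegative ground state that vanishes on a set of positive measure vanishes. -/
theorem GroundLimit.ae_zero_of_nonneg (hV : IsPotential V) (hs : SuppIn V ρ)
    (hn : FormNonneg V) (hρ : 0 < ρ) {f : ℕ → E3 → ℝ} {u : E3 → ℝ} (h : GroundLimit V ρ f u)
    (hf0 : ∀ n x, 0 ≤ f n x) (hA : ¬ ∀ᵐ x ∂(ballMeasure ρ), u x ≠ 0) :
    ∀ᵐ x ∂(ballMeasure ρ), u x = 0 := by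
  set μ := ballMeasure ρ
  obtain ⟨K, hK⟩ := h.exists_dirichlet_le hV hs
  obtain ⟨φ, hφ, hae⟩ := h.exists_subseq_ae
  obtain ⟨C, hCtop, hC⟩ := exists_log_oscillation_bound hV hn (fun n => h.test (φ n))
    (fun n => hf0 (φ n)) (h.form_tendsto.comp hφ.tendsto_atTop) (fun n => hK (φ n)) hρ
  have hu0 : ∀ᵐ x ∂μ, 0 ≤ u x := by
    filter_upwards [hae] with x hx
    exact ge_of_tendsto' hx fun n => hf0 _ x
  lift C to NNReal using hCtop
  set A : Set E3 := {x | u x = 0}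
  have hA0 : μ A ≠ 0 := by
    intro h0
    exact hA (by rw [ae_iff]; simpa [A] using h0)
  -- The oscillation bound passes to the limit u at fixed ε by Fatou's lemma, applied in y and then
  -- in x.
  have key : ∀ ε : ℝ, 0 < ε →
      ∫⁻ x, ∫⁻ y, ENNReal.ofReal ((Real.log (u y + ε) - Real.log (u x + ε)) ^ 2) ∂μ ∂μ ≤ C := by
    intro ε hε
    set F : ℕ → E3 → E3 → ENNReal := fun n x y =>
      ENNReal.ofReal ((Real.log (f (φ n) y + ε) - Real.log (f (φ n) x + ε)) ^ 2)
    have hFm : ∀ n, Measurable (Function.uncurry (F n)) := fun n => by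
      have hm : Measurable (f (φ n)) := (h.test _).continuous.measurable
      exact (((((hm.comp measurable_snd).add_const ε).log).sub
        (((hm.comp measurable_fst).add_const ε).log)).pow_const 2).ennreal_ofReal
    have hFlim : ∀ᵐ x ∂μ, ∀ᵐ y ∂μ, Tendsto (fun n => F n x y) atTop
        (𝓝 (ENNReal.ofReal ((Real.log (u y + ε) - Real.log (u x + ε)) ^ 2))) := by
      filter_upwards [hae, hu0] with x hx hx0
      filter_upwards [hae, hu0] with y hy hy0
      refine ENNReal.tendsto_ofReal (Tendsto.pow (Tendsto.sub ?_ ?_) 2)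
      · exact (hy.add_const ε).log (by positivity)
      · exact (hx.add_const ε).log (by positivity)
    calc _ ≤ ∫⁻ x, ∫⁻ y, liminf (fun n => F n x y) atTop ∂μ ∂μ := by
          refine lintegral_mono_ae ?_
          filter_upwards [hFlim] with x hx
          refine lintegral_mono_ae ?_
          filter_upwards [hx] with y hy
          exact hy.liminf_eq.ge
      _ ≤ ∫⁻ x, liminf (fun n => ∫⁻ y, F n x y ∂μ) atTop ∂μ := by
          refine lintegral_mono fun x => lintegral_liminf_le fun n => ?_
          exact (hFm n).comp measurable_prodMk_left
      _ ≤ liminf (fun n => ∫⁻ x, ∫⁻ y, F n x y ∂μ ∂μ) atTop :=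
          lintegral_liminf_le fun n => (hFm n).lintegral_prod_right
      _ ≤ C := by
          refine liminf_le_of_le (by isBoundedDefault) fun b hb => ?_
          obtain ⟨n, h1, h2⟩ := (hb.and (hC ε hε)).exists
          exact h1.trans h2
  have hPs : ∀ s : ℝ, 0 < s → μ {x | s ≤ u x} = 0 := by
    intro s hs0
    by_contra hne
    have hbd : ∀ L : ℝ, 0 < L → ENNReal.ofReal L * (μ A * μ {x | s ≤ u x}) ≤ C := by
      intro L hL
      -- With this ε, log(u(y)+ε) - log(u(x)+ε) ≥ √L whenever u(y) ≥ s and u(x) = 0, so the double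
      -- integral is at least L times the product of the measures of these two sets.
      set ε := s * Real.exp (-Real.sqrt L)
      have hε : 0 < ε := by positivity
      refine le_trans ?_ (key ε hε)
      have hin : ∀ x ∈ A, ENNReal.ofReal L * μ {y | s ≤ u y} ≤
          ∫⁻ y, ENNReal.ofReal ((Real.log (u y + ε) - Real.log (u x + ε)) ^ 2) ∂μ := by
        intro x hx
        have hx0 : u x = 0 := hx
        have := lintegral_mono_set (μ := μ) (Set.subset_univ {y | s ≤ u y}) (f := fun y =>
          ENNReal.ofReal ((Real.log (u y + ε) - Real.log (u x + ε)) ^ 2))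
        rw [setLIntegral_univ] at this
        refine le_trans ?_ this
        have hnull : NullMeasurableSet {y | s ≤ u y} μ :=
          nullMeasurableSet_le aemeasurable_const h.memLp.1.aemeasurable
        rw [← setLIntegral_const]
        refine lintegral_mono_ae ((ae_restrict_iff'₀ hnull).2 (Eventually.of_forall fun y hy => ?_))
        refine ENNReal.ofReal_le_ofReal ?_
        have hy' : s ≤ u y := hy
        have h1 : Real.sqrt L ≤ Real.log (u y + ε) - Real.log (u x + ε) := by
          rw [hx0, zero_add]
          have : Real.log ε = Real.log s - Real.sqrt L := by
            rw [Real.log_mul hs0.ne' (Real.exp_pos _).ne', Real.log_exp]; ring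
          have h2 : Real.log s ≤ Real.log (u y + ε) := Real.log_le_log hs0 (by linarith)
          linarith
        calc L = Real.sqrt L ^ 2 := (Real.sq_sqrt hL.le).symm
          _ ≤ _ := by gcongr
      have hnullA : NullMeasurableSet A μ :=
        nullMeasurableSet_eq_fun h.memLp.1.aemeasurable aemeasurable_const
      calc ENNReal.ofReal L * (μ A * μ {x | s ≤ u x})
          = ∫⁻ _ in A, ENNReal.ofReal L * μ {y | s ≤ u y} ∂μ := by
            rw [setLIntegral_const]; ring
        _ ≤ ∫⁻ x in A, ∫⁻ y, ENNReal.ofReal ((Real.log (u y + ε) - Real.log (u x + ε)) ^ 2) ∂μ ∂μ :=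
            lintegral_mono_ae ((ae_restrict_iff'₀ hnullA).2 (Eventually.of_forall hin))
        _ ≤ _ := setLIntegral_le_lintegral _ _
    have hm0 : μ A * μ {x | s ≤ u x} ≠ 0 := mul_ne_zero hA0 hne
    have hmt : μ A * μ {x | s ≤ u x} ≠ ⊤ :=
      ENNReal.mul_ne_top (measure_ne_top _ _) (measure_ne_top _ _)
    set m := (μ A * μ {x | s ≤ u x}).toReal
    have hm : 0 < m := ENNReal.toReal_pos hm0 hmt
    -- L is chosen to make the lower bound C + 1, exceeding the uniform bound C.
    have h1 := hbd ((C + 1) / m) (by positivity)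
    rw [← ENNReal.ofReal_toReal hmt, ← ENNReal.ofReal_mul (by positivity),
      ENNReal.coe_nnreal_eq, ENNReal.ofReal_le_ofReal_iff (by positivity)] at h1
    change (C + 1) / m * m ≤ _ at h1
    rw [div_mul_cancel₀ _ hm.ne'] at h1
    linarith
  have hall : ∀ᵐ x ∂μ, ∀ k : ℕ, ¬ (1 / ((k : ℝ) + 1) ≤ u x) := by
    rw [ae_all_iff]
    intro k
    rw [ae_iff]
    simpa using hPs (1 / ((k : ℝ) + 1)) (by positivity)
  filter_upwards [hall, hu0] with x hx hx0
  refine le_antisymm ?_ hx0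
  refine ge_of_tendsto' (tendsto_one_div_add_atTop_nhds_zero_nat (𝕜 := ℝ)) fun k => ?_
  exact (not_le.1 (hx k)).le

/-- A ground state vanishes almost everywhere or almost nowhere. -/
theorem IsGround.ae_eq_zero_or_ae_ne_zero (hV : IsPotential V) (hs : SuppIn V ρ)
    (hn : FormNonneg V) (hρ : 0 < ρ) {u : E3 → ℝ} (h : IsGround V ρ u) :
    (∀ᵐ x ∂(ballMeasure ρ), u x = 0) ∨ ∀ᵐ x ∂(ballMeasure ρ), u x ≠ 0 := by
  obtain ⟨f, hf⟩ := h
  obtain ⟨g, hg, hg0⟩ := hf.exists_abs hV hs hn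
  by_cases hA : ∀ᵐ x ∂(ballMeasure ρ), u x ≠ 0
  · exact Or.inr hA
  · left
    have := hg.ae_zero_of_nonneg hV hs hn hρ hg0 (by simpa using hA)
    simpa using this

/-- A ground state has a constant sign. -/
theorem IsGround.sign (hV : IsPotential V) (hs : SuppIn V ρ) (hn : FormNonneg V) (hρ : 0 < ρ)
    {u : E3 → ℝ} (h : IsGround V ρ u) :
    (∀ᵐ x ∂(ballMeasure ρ), u x ≤ 0) ∨ ∀ᵐ x ∂(ballMeasure ρ), 0 < u x := by
  obtain ⟨f, hf⟩ := h
  obtain ⟨g, hg, hg0⟩ := hf.exists_abs hV hs hn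
  -- |u| + u vanishes exactly where u ≤ 0, so the zero-or-nonzero alternative for it is the sign
  -- alternative for u.
  have hplus : IsGround V ρ (fun x => 1 * |u x| + 1 * u x) := ⟨_, hg.lin hV hn hf 1 1⟩
  rcases hplus.ae_eq_zero_or_ae_ne_zero hV hs hn hρ with h0 | h0
  · left
    filter_upwards [h0] with x hx
    linarith [abs_nonneg (u x)]
  · right
    filter_upwards [h0] with x hx
    by_contra! hle
    exact hx (by rw [abs_of_nonpos hle]; ring)

/-- Ground states are unique up to a scalar factor. -/
theorem IsGround.exists_ae_eq_const_mul (hV : IsPotential V) (hs : SuppIn V ρ)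
    (hn : FormNonneg V) (hρ : 0 < ρ) {u v : E3 → ℝ} (hu : IsGround V ρ u) (hv : IsGround V ρ v)
    (hu0 : 0 < ∫ x, u x ^ 2 ∂(ballMeasure ρ)) :
    ∃ c : ℝ, ∀ᵐ x ∂(ballMeasure ρ), v x = c * u x := by
  obtain ⟨f, hf⟩ := hu
  obtain ⟨g, hg⟩ := hv
  have iu : Integrable u (ballMeasure ρ) := hf.memLp.integrable (by norm_num)
  have iv : Integrable v (ballMeasure ρ) := hg.memLp.integrable (by norm_num)
  have hI : ∫ x, u x ∂(ballMeasure ρ) ≠ 0 := by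
    intro h0
    have hz : ∀ᵐ x ∂(ballMeasure ρ), u x = 0 := by
      rcases IsGround.sign hV hs hn hρ ⟨f, hf⟩ with h1 | h1
      · have h2 : 0 ≤ᵐ[ballMeasure ρ] fun x => -u x := by
          filter_upwards [h1] with x hx; simpa using hx
        have := (integral_eq_zero_iff_of_nonneg_ae h2 iu.neg).1 (by
          rw [integral_neg, h0, neg_zero])
        filter_upwards [this] with x hx
        simpa using hx
      · exact (integral_eq_zero_iff_of_nonneg_ae (h1.mono fun x hx => hx.le) iu).1 h0
    have : ∫ x, u x ^ 2 ∂(ballMeasure ρ) = 0 := by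
      refine integral_eq_zero_of_ae ?_
      filter_upwards [hz] with x hx; simp [hx]
    linarith
  -- This c gives v - c u mean zero on the ball; a ground state of constant sign and zero mean
  -- vanishes almost everywhere.
  set c := (∫ x, v x ∂(ballMeasure ρ)) / ∫ x, u x ∂(ballMeasure ρ)
  refine ⟨c, ?_⟩
  have hw : IsGround V ρ (fun x => 1 * v x + (-c) * u x) := ⟨_, hg.lin hV hn hf 1 (-c)⟩
  have iw : Integrable (fun x => 1 * v x + (-c) * u x) (ballMeasure ρ) :=
    (iv.const_mul 1).add (iu.const_mul (-c))
  have hw0 : ∫ x, (1 * v x + (-c) * u x) ∂(ballMeasure ρ) = 0 := by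
    rw [integral_add (iv.const_mul 1) (iu.const_mul (-c)), integral_const_mul, integral_const_mul]
    simp only [c]; field_simp; ring
  rcases hw.sign hV hs hn hρ with h1 | h1
  · have h2 : 0 ≤ᵐ[ballMeasure ρ] fun x => -(1 * v x + (-c) * u x) := by
      filter_upwards [h1] with x hx; simpa using hx
    have := (integral_eq_zero_iff_of_nonneg_ae h2 iw.neg).1 (by
      rw [integral_neg, hw0, neg_zero])
    filter_upwards [this] with x hx
    simp only [Pi.zero_apply] at hx
    linarith
  · have := (integral_eq_zero_iff_of_nonneg_ae (h1.mono fun x hx => hx.le) iw).1 hw0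
    filter_upwards [this] with x hx
    simp only [Pi.zero_apply] at hx
    linarith

/-! ### Critical coupling in terms of ground states -/

variable {V₀ : E3 → ℝ} {R : ℝ}

/-- If `-Δ + W n` fails to be nonnegative for potentials `W n` approaching `V`, then `-Δ + V` has a
nonzero ground state, approximated by normalised test functions on which the forms of a subsequence
of the `W n` are negative. -/
theorem exists_groundLimit_of_not_formNonneg (hV : IsPotential V) (hs : SuppIn V ρ)
    (hn : FormNonneg V) {W : ℕ → E3 → ℝ} (hWs : ∀ n, SuppIn (W n) ρ)
    (hW : ∀ n, ¬ FormNonneg (W n)) {e : ℕ → ℝ} (he : Tendsto e atTop (𝓝 0))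
    (hle : ∀ n f, IsTest f → dirichlet f f = 1 → form V f f ≤ form (W n) f f + e n) :
    ∃ (f : ℕ → E3 → ℝ) (u : E3 → ℝ) (φ : ℕ → ℕ), StrictMono φ ∧ GroundLimit V ρ f u ∧
      0 < ∫ x, u x ^ 2 ∂(ballMeasure ρ) ∧ (∀ n, dirichlet (f n) (f n) = 1) ∧
      ∀ n, form (W (φ n)) (f n) (f n) < 0 := by
  choose f hf hf1 hneg using fun n => exists_normalized (hWs n) (hW n)
  have hlim : Tendsto (fun n => form V (f n) (f n)) atTop (𝓝 0) :=
    squeeze_zero (fun n => hn _ (hf n))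
      (fun n => (hle n _ (hf n) (hf1 n)).trans (by linarith [hneg n])) he
  obtain ⟨φ, hφ, u, hG, hu⟩ := exists_groundLimit hV hs hf hf1 hlim
  refine ⟨fun n => f (φ n), u, φ, hφ, hG, ?_, fun n => hf1 _, fun n => hneg _⟩
  exact integral_sq_pos_of_integral_ne hG.memLp (W := V) (by rw [hu]; norm_num)

lemma form_const_mul_pot (V f : E3 → ℝ) (c : ℝ) :
    form (fun x => c * V x) f f = form V f f + (c - 1) * potForm V f f := by
  have : potForm (fun x => c * V x) f f = c * potForm V f f := by
    unfold potForm
    rw [← integral_const_mul]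
    congr 1; ext x; ring
  simp only [form, this]; ring

lemma IsPotential.const_mul (hV : IsPotential V) (c : ℝ) : IsPotential (fun x => c * V x) := by
  obtain ⟨M, hM⟩ := hV.bdd
  refine ⟨hV.meas.const_mul c, |c| * M, fun x => ?_⟩
  rw [abs_mul]
  exact mul_le_mul_of_nonneg_left (hM x) (abs_nonneg c)

lemma SuppIn.const_mul (hs : SuppIn V ρ) (c : ℝ) : SuppIn (fun x => c * V x) ρ := fun x hx => by
  simp [hs x hx]

/-- Critical coupling means nonnegativity together with existence of a nonzero ground state. -/
theorem atCriticalCoupling_iff (hV : IsPotential V) (hs : SuppIn V ρ) :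
    AtCriticalCoupling V ↔
      FormNonneg V ∧ ∃ u, IsGround V ρ u ∧ 0 < ∫ x, u x ^ 2 ∂(ballMeasure ρ) := by
  unfold AtCriticalCoupling
  rw [schrodingerNonneg_iff hV]
  simp only [fun ε : ℝ => schrodingerNonneg_iff (hV.const_mul (1 + ε))]
  refine and_congr_right fun hn => ⟨fun h => ?_, ?_⟩
  · obtain ⟨C, hC0, hC⟩ := exists_potForm_le hV hs
    have he : Tendsto (fun n : ℕ => 1 / ((n : ℝ) + 1) * C) atTop (𝓝 0) := by
      simpa using (tendsto_one_div_add_atTop_nhds_zero_nat (𝕜 := ℝ)).mul_const C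
    obtain ⟨f, u, -, -, hG, hu, -⟩ := exists_groundLimit_of_not_formNonneg hV hs hn
      (W := fun n x => (1 + 1 / ((n : ℝ) + 1)) * V x) (fun n => hs.const_mul _)
      (fun n => h _ (by positivity)) he (fun n f hf h1 => by
        have h2 := hC f hf
        rw [form_const_mul_pot, add_sub_cancel_left]
        have h3 : 0 ≤ 1 / ((n : ℝ) + 1) := by positivity
        have h4 : 0 ≤ C + potForm V f f := by
          rw [h1, mul_one] at h2
          linarith [neg_abs_le (potForm V f f)]
        nlinarith [mul_nonneg h3 h4])
    exact ⟨u, ⟨f, hG⟩, hu⟩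
  · rintro ⟨u, ⟨f, hG⟩, hu⟩ ε hε hcon
    have h1 := hG.integral_neg hV hs hu
    -- Along f_n the form of (1 + ε)V tends to ε∫Vu², which is negative, whereas nonnegativity would
    -- make the limit nonnegative.
    have h2 := hG.form_tendsto.add ((hG.tendsto_quad hV hs).const_mul ε)
    have h3 := ge_of_tendsto' (b := 0) h2 fun n => by
      have := hcon _ (hG.test n)
      rwa [form_const_mul_pot, add_sub_cancel_left] at this
    nlinarith

/-! ### The perturbed potential and its critical coupling -/

section perturbed

lemma isPotential_chiR (R : ℝ) : IsPotential (chiR R) := by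
  refine ⟨measurable_const.indicator (measurableSet_le measurable_norm measurable_const), 1,
    fun x => ?_⟩
  unfold chiR Set.indicator
  split_ifs <;> simp

lemma measurableSet_annulus (R : ℝ) : MeasurableSet {r : E3 | R < ‖r‖ ∧ ‖r‖ ≤ 2 * R} :=
  (measurableSet_lt measurable_const measurable_norm).inter
    (measurableSet_le measurable_norm measurable_const)

lemma isPotential_etaR (R : ℝ) : IsPotential (etaR R) := by
  refine ⟨measurable_const.indicator (measurableSet_annulus R), 1, fun x => ?_⟩
  unfold etaR Set.indicator
  split_ifs <;> simp

lemma chiR_nonneg (R : ℝ) (x : E3) : 0 ≤ chiR R x :=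
  Set.indicator_nonneg (fun _ _ => zero_le_one) x

lemma etaR_nonneg (R : ℝ) (x : E3) : 0 ≤ etaR R x :=
  Set.indicator_nonneg (fun _ _ => zero_le_one) x

lemma suppIn_chiR (hR : 0 < R) (hρ : 2 * R ≤ ρ) : SuppIn (chiR R) ρ := fun x hx =>
  Set.indicator_of_notMem (by simp only [Set.mem_ofPred_eq, not_le]; linarith) _

lemma suppIn_etaR (hρ : 2 * R ≤ ρ) : SuppIn (etaR R) ρ := fun x hx =>
  Set.indicator_of_notMem (by simp only [Set.mem_ofPred_eq, not_and, not_le]; intro; linarith) _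

lemma potForm_nonneg {W : E3 → ℝ} (hW : ∀ x, 0 ≤ W x) (f : E3 → ℝ) : 0 ≤ potForm W f f :=
  integral_nonneg fun x => mul_nonneg (hW x) (mul_self_nonneg _)

lemma isPotential_perturbed (hV : IsPotential V₀) (R l b : ℝ) :
    IsPotential (perturbedPotential V₀ R l b) := by
  obtain ⟨M, hM⟩ := hV.bdd
  obtain ⟨M1, hM1⟩ := (isPotential_chiR R).bdd
  obtain ⟨M2, hM2⟩ := (isPotential_etaR R).bdd
  refine ⟨(hV.meas.add ((isPotential_chiR R).meas.const_mul l)).sub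
    ((isPotential_etaR R).meas.const_mul b), M + |l| * M1 + |b| * M2, fun x => ?_⟩
  unfold perturbedPotential
  calc _ ≤ |V₀ x + l * chiR R x| + |b * etaR R x| := abs_sub _ _
    _ ≤ |V₀ x| + |l * chiR R x| + |b * etaR R x| := by gcongr; exact abs_add_le _ _
    _ ≤ _ := by
      rw [abs_mul, abs_mul]
      gcongr
      exacts [hM x, hM1 x, hM2 x]

lemma suppIn_perturbed (hs : SuppIn V₀ ρ) (hR : 0 < R) (hρ : 2 * R ≤ ρ) (l b : ℝ) :
    SuppIn (perturbedPotential V₀ R l b) ρ := fun x hx => by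
  simp [perturbedPotential, hs x hx, suppIn_chiR hR hρ x hx, suppIn_etaR hρ x hx]

lemma form_perturbed (hV : IsPotential V₀) (R l b : ℝ) {f : E3 → ℝ} (hf : IsTest f) :
    form (perturbedPotential V₀ R l b) f f =
      form V₀ f f + l * potForm (chiR R) f f - b * potForm (etaR R) f f := by
  have h1 := hf.integrable_pot hV hf
  have h2 := (hf.integrable_pot (isPotential_chiR R) hf).const_mul l
  have h3 := (hf.integrable_pot (isPotential_etaR R) hf).const_mul b
  have : potForm (perturbedPotential V₀ R l b) f f =
      potForm V₀ f f + l * potForm (chiR R) f f - b * potForm (etaR R) f f := by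
    unfold potForm perturbedPotential
    rw [← integral_const_mul, ← integral_const_mul, ← integral_add h1 h2, ← integral_sub _ h3]
    · congr 1; ext x; ring
    · exact h1.add h2
  simp only [form, this]; ring

/-- A zero integral would force g = 0 almost everywhere on the open annulus, which has positive
measure. -/
lemma integral_etaR_pos (hR : 0 < R) (hρ : 2 * R ≤ ρ) {g : E3 → ℝ}
    (hg : MemLp g 2 (ballMeasure ρ))
    (h : ∀ᵐ x ∂(ballMeasure ρ), R < ‖x‖ → ‖x‖ ≤ 2 * R → g x ≠ 0) :
    0 < ∫ x, etaR R x * g x ^ 2 ∂(ballMeasure ρ) := by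
  refine (integral_nonneg fun x => mul_nonneg (etaR_nonneg R x) (sq_nonneg _)).lt_of_ne fun h0 => ?_
  obtain ⟨M, hM⟩ := (isPotential_etaR R).bdd
  have hi : Integrable (fun x => etaR R x * g x ^ 2) (ballMeasure ρ) :=
    hg.integrable_sq.bdd_mul (isPotential_etaR R).meas.aestronglyMeasurable
      (Eventually.of_forall hM)
  have h1 := (integral_eq_zero_iff_of_nonneg
    (fun x => mul_nonneg (etaR_nonneg R x) (sq_nonneg _)) hi).1 h0.symm
  set U : Set E3 := {x | R < ‖x‖ ∧ ‖x‖ < 2 * R}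
  have hUo : IsOpen U := (isOpen_lt continuous_const continuous_norm).inter
    (isOpen_lt continuous_norm continuous_const)
  have hUne : U.Nonempty := by
    refine ⟨EuclideanSpace.single 0 (3 / 2 * R), ?_⟩
    simp only [U, Set.mem_ofPred_eq, PiLp.norm_single, Real.norm_eq_abs,
      abs_of_pos (by positivity : 0 < 3 / 2 * R)]
    constructor <;> linarith
  have hpos : volume U ≠ 0 := (hUo.measure_pos volume hUne).ne'
  apply hpos
  have h2 : ∀ᵐ x ∂(ballMeasure ρ), x ∉ U := by
    filter_upwards [h, h1] with x hx hx0 hxU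
    have hxe : etaR R x = 1 := Set.indicator_of_mem
      (show x ∈ {r : E3 | R < ‖r‖ ∧ ‖r‖ ≤ 2 * R} from ⟨hxU.1, hxU.2.le⟩) _
    simp only [hxe, one_mul, Pi.zero_apply] at hx0
    exact hx hxU.1 hxU.2.le (by simpa using hx0)
  rw [ae_restrict_iff' measurableSet_closedBall] at h2
  rw [← nonpos_iff_eq_zero]
  refine (measure_mono fun x hx => ?_).trans_eq (ae_iff.1 h2)
  simp only [Set.mem_ofPred_eq, Classical.not_imp, not_not]
  exact ⟨by rw [mem_closedBall_zero_iff]; linarith [hx.2], hx⟩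

/-- This is the role of unique continuation here: a nonzero ground state cannot vanish on the
annulus, so changing b does move the form. -/
lemma IsGround.integral_etaR_pos (hV : IsPotential V) (hs : SuppIn V ρ) (hn : FormNonneg V)
    (hR : 0 < R) (hρ : 2 * R ≤ ρ) {u : E3 → ℝ} (h : IsGround V ρ u)
    (hu : 0 < ∫ x, u x ^ 2 ∂(ballMeasure ρ)) :
    0 < ∫ x, etaR R x * u x ^ 2 ∂(ballMeasure ρ) := by
  have hm : MemLp u 2 (ballMeasure ρ) := by obtain ⟨f, hf⟩ := h; exact hf.memLp
  refine CriticalCoupling.integral_etaR_pos hR hρ hm ?_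
  rcases h.ae_eq_zero_or_ae_ne_zero hV hs hn (by linarith) with h0 | h0
  · have : ∫ x, u x ^ 2 ∂(ballMeasure ρ) = 0 := by
      refine integral_eq_zero_of_ae ?_
      filter_upwards [h0] with x hx; simp [hx]
    linarith
  · filter_upwards [h0] with x hx _ _ using hx

/-- The largest coupling `b` keeping `-Δ + V₀ + l χ_R - b η_R` nonnegative. -/
def critB (V₀ : E3 → ℝ) (R l : ℝ) : ℝ := sSup {b | FormNonneg (perturbedPotential V₀ R l b)}

/-- A single cutoff equal to 1 on the ball of radius 2R has positive annulus mass, and its form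
value bounds every admissible b. -/
lemma bddAbove_formNonneg (hV : IsPotential V₀) (hR : 0 < R) (l : ℝ) :
    BddAbove {b | FormNonneg (perturbedPotential V₀ R l b)} := by
  obtain ⟨ζ, hζ, -, -, hζ1, -⟩ := exists_cutoff (r := 2 * R) (R := 3 * R) (by positivity)
    (by linarith)
  have hY : 0 < potForm (etaR R) ζ ζ := by
    rw [(suppIn_etaR le_rfl).potForm_self]
    refine integral_etaR_pos hR le_rfl (hζ.memLp _) (Eventually.of_forall fun x _ hx => ?_)
    rw [hζ1 x hx]; norm_num
  refine ⟨(form V₀ ζ ζ + l * potForm (chiR R) ζ ζ) / potForm (etaR R) ζ ζ, fun b hb => ?_⟩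
  have := hb _ hζ
  rw [form_perturbed hV R l b hζ] at this
  rw [le_div_iff₀ hY]
  linarith

/-- For fixed f the form is affine in b. If f has zero annulus mass, b plays no role; otherwise a
negative value at the supremum would persist for some admissible b close to it. -/
lemma formNonneg_critB (hV : IsPotential V₀) {l b : ℝ}
    (hb : FormNonneg (perturbedPotential V₀ R l b)) :
    FormNonneg (perturbedPotential V₀ R l (critB V₀ R l)) := by
  intro f hf
  by_contra! hneg
  rw [form_perturbed hV R l _ hf] at hneg
  have hY0 := potForm_nonneg (etaR_nonneg R) f
  have hY : 0 < potForm (etaR R) f f := by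
    refine hY0.lt_of_ne fun h0 => ?_
    have := hb f hf
    rw [form_perturbed hV R l _ hf] at this
    rw [← h0] at this hneg
    linarith
  have h1 : (form V₀ f f + l * potForm (chiR R) f f) / potForm (etaR R) f f < critB V₀ R l := by
    rw [div_lt_iff₀ hY]; linarith
  obtain ⟨b', hb', hlt⟩ := exists_lt_of_lt_csSup ⟨b, hb⟩ h1
  have := hb' f hf
  rw [form_perturbed hV R l _ hf] at this
  rw [div_lt_iff₀ hY] at hlt
  linarith

lemma le_critB (hV : IsPotential V₀) (hR : 0 < R) {l b : ℝ}
    (hb : FormNonneg (perturbedPotential V₀ R l b)) : b ≤ critB V₀ R l :=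
  le_csSup (bddAbove_formNonneg hV hR l) hb

/-- The potential at the largest admissible `b` is at critical coupling. -/
theorem atCriticalCoupling_critB (hV : IsPotential V₀) (hs : SuppIn V₀ ρ) (hR : 0 < R)
    (hρ : 2 * R ≤ ρ) {l b : ℝ} (hb : FormNonneg (perturbedPotential V₀ R l b)) :
    AtCriticalCoupling (perturbedPotential V₀ R l (critB V₀ R l)) := by
  have hn := formNonneg_critB hV hb
  rw [atCriticalCoupling_iff (isPotential_perturbed hV R l _) (suppIn_perturbed hs hR hρ l _)]
  refine ⟨hn, ?_⟩
  obtain ⟨C, hC0, hC⟩ := exists_potForm_le (isPotential_etaR R) (suppIn_etaR hρ)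
  have he : Tendsto (fun n : ℕ => 1 / ((n : ℝ) + 1) * C) atTop (𝓝 0) := by
    simpa using (tendsto_one_div_add_atTop_nhds_zero_nat (𝕜 := ℝ)).mul_const C
  -- Every b strictly above the supremum is inadmissible; the resulting negative test functions at b
  -- + 1/(n+1) converge to a ground state at b.
  obtain ⟨f, u, -, -, hG, hu, -⟩ := exists_groundLimit_of_not_formNonneg
    (isPotential_perturbed hV R l _) (suppIn_perturbed hs hR hρ l _) hn
    (W := fun n : ℕ => perturbedPotential V₀ R l (critB V₀ R l + 1 / ((n : ℝ) + 1)))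
    (fun n => suppIn_perturbed hs hR hρ l _)
    (fun n hcon => by
      have := le_critB hV hR hcon
      have : 0 < 1 / ((n : ℝ) + 1) := by positivity
      linarith) he (fun n f hf h1 => by
        have h2 := hC f hf
        rw [form_perturbed hV R l _ hf, form_perturbed hV R l _ hf]
        have h3 : 0 ≤ 1 / ((n : ℝ) + 1) := by positivity
        have h4 : potForm (etaR R) f f ≤ C := by
          rw [h1, mul_one] at h2
          exact (le_abs_self _).trans h2
        nlinarith [mul_le_mul_of_nonneg_left h4 h3])
  exact ⟨u, ⟨f, hG⟩, hu⟩

/-- The critical `b` is unique. -/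
theorem eq_critB_of_atCriticalCoupling (hV : IsPotential V₀) (hs : SuppIn V₀ ρ) (hR : 0 < R)
    (hρ : 2 * R ≤ ρ) {l b : ℝ} (h : AtCriticalCoupling (perturbedPotential V₀ R l b)) :
    b = critB V₀ R l := by
  have hV' := isPotential_perturbed hV R l b
  have hs' := suppIn_perturbed hs hR hρ l b
  obtain ⟨hn, u, ⟨f, hG⟩, hu⟩ := (atCriticalCoupling_iff hV' hs').1 h
  refine (le_critB hV hR hn).antisymm ?_
  by_contra! hlt
  have hY := IsGround.integral_etaR_pos hV' hs' hn hR hρ ⟨f, hG⟩ hu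
  -- If b were below the supremum, its ground state would give the form at `critB` the limit -(critB
  -- - b)Y < 0.
  have h1 := hG.form_tendsto.sub ((hG.tendsto_quad (isPotential_etaR R)
    (suppIn_etaR hρ)).const_mul (critB V₀ R l - b))
  have h2 := ge_of_tendsto' (b := 0) h1 fun n => by
    have := formNonneg_critB hV hn _ (hG.test n)
    rw [form_perturbed hV R l _ (hG.test n)] at this
    rw [form_perturbed hV R l _ (hG.test n)]
    linarith
  nlinarith

/-- Slightly negative `l` can be compensated by a negative `b`. -/
theorem exists_formNonneg_neg (hV : IsPotential V₀) (hs : SuppIn V₀ ρ) (hR : 0 < R)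
    (hρ : 2 * R ≤ ρ) (hn : FormNonneg V₀) :
    ∃ δ : ℝ, 0 < δ ∧ ∀ l, -δ < l → FormNonneg (perturbedPotential V₀ R l (-1)) := by
  obtain ⟨n, hnn⟩ : ∃ n : ℕ, FormNonneg (perturbedPotential V₀ R (-(1 / ((n : ℝ) + 1))) (-1)) := by
    by_contra! hcon
    obtain ⟨C, hC0, hC⟩ := exists_potForm_le (isPotential_chiR R) (suppIn_chiR hR hρ)
    have he : Tendsto (fun n : ℕ => 1 / ((n : ℝ) + 1) * C) atTop (𝓝 0) := by
      simpa using (tendsto_one_div_add_atTop_nhds_zero_nat (𝕜 := ℝ)).mul_const C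
    have hX : ∀ f, IsTest f → dirichlet f f = 1 → potForm (chiR R) f f ≤ C := fun f hf h1 => by
      have h2 := hC f hf
      rw [h1, mul_one] at h2
      exact (le_abs_self _).trans h2
    obtain ⟨f, u, φ, hφ, hG, hu, h1, hneg⟩ := exists_groundLimit_of_not_formNonneg hV hs hn
      (fun n => suppIn_perturbed hs hR hρ _ _) hcon he (fun n f hf h1 => by
        rw [form_perturbed hV R _ _ hf]
        have h3 : 0 ≤ 1 / ((n : ℝ) + 1) := by positivity
        have h4 := potForm_nonneg (etaR_nonneg R) f
        nlinarith [mul_le_mul_of_nonneg_left (hX f hf h1) h3])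
    have hY := IsGround.integral_etaR_pos hV hs hn hR hρ ⟨f, hG⟩ hu
    -- The penalty from b = -1 adds the annulus mass, so negativity forces that mass below C/(φ n +
    -- 1). In the limit the ground state of V₀ would have no mass on the annulus.
    have := le_of_tendsto_of_tendsto' (hG.tendsto_quad (isPotential_etaR R) (suppIn_etaR hρ))
      (he.comp hφ.tendsto_atTop) fun n => by
        have h5 := hneg n
        rw [form_perturbed hV R _ _ (hG.test n)] at h5
        have h3 : 0 ≤ 1 / ((φ n : ℝ) + 1) := by positivity
        have h6 := hn _ (hG.test n)
        have h7 := mul_le_mul_of_nonneg_left (hX _ (hG.test n) (h1 n)) h3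
        simp only [Function.comp_apply]
        linarith
    linarith
  refine ⟨1 / ((n : ℝ) + 1), by positivity, fun l hl f hf => ?_⟩
  have h1 := hnn f hf
  rw [form_perturbed hV R _ _ hf] at h1 ⊢
  nlinarith [mul_le_mul_of_nonneg_right hl.le (potForm_nonneg (chiR_nonneg R) f)]

/-! ### Differentiability of the critical coupling -/

/-- The derivative of the critical coupling in terms of a ground state. -/
theorem hasDerivAt_critB (hV : IsPotential V₀) (hs : SuppIn V₀ ρ) (hR : 0 < R)
    (hρ : 2 * R ≤ ρ) {l₀ : ℝ}
    (hnear : ∀ᶠ l in 𝓝 l₀, ∃ b, FormNonneg (perturbedPotential V₀ R l b)) {u : E3 → ℝ}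
    (hG : IsGround (perturbedPotential V₀ R l₀ (critB V₀ R l₀)) ρ u)
    (hu : 0 < ∫ x, u x ^ 2 ∂(ballMeasure ρ)) :
    HasDerivAt (critB V₀ R) ((∫ x, chiR R x * u x ^ 2 ∂(ballMeasure ρ)) /
      ∫ x, etaR R x * u x ^ 2 ∂(ballMeasure ρ)) l₀ := by
  set B := critB V₀ R
  set X := ∫ x, chiR R x * u x ^ 2 ∂(ballMeasure ρ)
  set Y := ∫ x, etaR R x * u x ^ 2 ∂(ballMeasure ρ)
  set r := X / Y
  set W := perturbedPotential V₀ R l₀ (B l₀)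
  have hW : IsPotential W := isPotential_perturbed hV R _ _
  have hWs : SuppIn W ρ := suppIn_perturbed hs hR hρ _ _
  have hn : FormNonneg W := by
    obtain ⟨b, hb⟩ := hnear.self_of_nhds
    exact formNonneg_critB hV hb
  have hY : 0 < Y := hG.integral_etaR_pos hW hWs hn hR hρ hu
  have hXY : X = r * Y := by simp only [r]; field_simp
  have hshift : ∀ l b f, IsTest f → form (perturbedPotential V₀ R l b) f f = form W f f +
      (l - l₀) * potForm (chiR R) f f - (b - B l₀) * potForm (etaR R) f f := fun l b f hf => by
    rw [form_perturbed hV R _ _ hf, form_perturbed hV R _ _ hf]; ring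
  -- Testing the critical potential at l with the ground state at l₀ puts `critB` below its tangent
  -- line there; only the lower bound remains.
  have hupper : ∀ l, (∃ b, FormNonneg (perturbedPotential V₀ R l b)) →
      B l - B l₀ ≤ r * (l - l₀) := by
    rintro l ⟨b, hb⟩
    obtain ⟨f, hf⟩ := hG
    have h1 := (hf.form_tendsto.add ((hf.tendsto_quad (isPotential_chiR R)
      (suppIn_chiR hR hρ)).const_mul (l - l₀))).sub ((hf.tendsto_quad (isPotential_etaR R)
      (suppIn_etaR hρ)).const_mul (B l - B l₀))
    have h2 := ge_of_tendsto' (b := 0) h1 fun n => by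
      have := formNonneg_critB hV hb _ (hf.test n)
      rwa [hshift _ _ _ (hf.test n)] at this
    change 0 ≤ 0 + (l - l₀) * X - (B l - B l₀) * Y at h2
    rw [hXY] at h2
    by_contra! hlt
    nlinarith [mul_lt_mul_of_pos_right hlt hY]
  rw [hasDerivAt_iff_isLittleO, Asymptotics.isLittleO_iff]
  intro κ hκ
  by_contra hcon
  obtain ⟨l, hl, hfail⟩ := exists_seq_forall_of_frequently
    ((not_eventually.1 hcon).and_eventually hnear)
  set h : ℕ → ℝ := fun n => l n - l₀
  have hh : Tendsto h atTop (𝓝 0) := by simpa using hl.sub_const l₀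
  -- Where differentiability fails, B(l n) lies more than κ|h n| below the tangent line. Half that
  -- gap makes b n inadmissible and still gives b n → B l₀.
  set b : ℕ → ℝ := fun n => B l₀ + r * h n - κ / 2 * |h n|
  have hb : Tendsto (fun n => b n - B l₀) atTop (𝓝 0) := by
    have : Tendsto (fun n => r * h n - κ / 2 * |h n|) atTop (𝓝 0) := by
      simpa using (hh.const_mul r).sub (hh.abs.const_mul (κ / 2))
    refine this.congr fun n => ?_
    simp only [b]; ring
  have hnot : ∀ n, ¬ FormNonneg (perturbedPotential V₀ R (l n) (b n)) := by
    intro n hbn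
    have h1 := le_critB hV hR hbn
    have h2 := hupper (l n) (hfail n).2
    have h3 := (hfail n).1
    rw [not_le, Real.norm_eq_abs, Real.norm_eq_abs, smul_eq_mul] at h3
    change κ * |h n| < |B (l n) - B l₀ - h n * r| at h3
    change B (l n) - B l₀ ≤ r * h n at h2
    change b n ≤ B (l n) at h1
    rw [abs_of_nonpos (a := B (l n) - B l₀ - h n * r) (by linarith)] at h3
    simp only [b] at h1
    nlinarith [abs_nonneg (h n)]
  obtain ⟨C, hC0, hC⟩ := exists_potForm_le (isPotential_chiR R) (suppIn_chiR hR hρ)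
  obtain ⟨D, hD0, hD⟩ := exists_potForm_le (isPotential_etaR R) (suppIn_etaR hρ)
  have he : Tendsto (fun n => |h n| * C + |b n - B l₀| * D) atTop (𝓝 0) := by
    simpa using (hh.abs.mul_const C).add (hb.abs.mul_const D)
  obtain ⟨f, v, φ, hφ, hGv, hv, -, hneg⟩ := exists_groundLimit_of_not_formNonneg hW hWs hn
    (fun n => suppIn_perturbed hs hR hρ _ _) hnot he (fun n f hf h1 => by
      rw [hshift (l n) (b n) f hf]
      have h2 := hC f hf
      have h3 := hD f hf
      rw [h1, mul_one] at h2 h3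
      have h4 : |(l n - l₀) * potForm (chiR R) f f| ≤ |h n| * C := by
        rw [abs_mul]; exact mul_le_mul_of_nonneg_left h2 (abs_nonneg _)
      have h5 : |(b n - B l₀) * potForm (etaR R) f f| ≤ |b n - B l₀| * D := by
        rw [abs_mul]; exact mul_le_mul_of_nonneg_left h3 (abs_nonneg _)
      linarith [neg_abs_le ((l n - l₀) * potForm (chiR R) f f),
        le_abs_self ((b n - B l₀) * potForm (etaR R) f f)])
  have hYv := IsGround.integral_etaR_pos hW hWs hn hR hρ ⟨f, hGv⟩ hv
  have hXlim := hGv.tendsto_quad (isPotential_chiR R) (suppIn_chiR hR hρ)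
  have hYlim := hGv.tendsto_quad (isPotential_etaR R) (suppIn_etaR hρ)
  -- The perturbed form is negative while that of W is nonnegative; cancelling |h| leaves κ/2 · Y_n
  -- ≤ |X_n - r Y_n|, which survives the limit.
  have hineq := le_of_tendsto_of_tendsto' (hYlim.const_mul (κ / 2))
    (hXlim.sub (hYlim.const_mul r)).abs fun n => by
      have h1 := hneg n
      rw [hshift _ _ _ (hGv.test n)] at h1
      have h2 := hn _ (hGv.test n)
      set Xn := potForm (chiR R) (f n) (f n)
      set Yn := potForm (etaR R) (f n) (f n)
      have h3 : h (φ n) * (Xn - r * Yn) + κ / 2 * |h (φ n)| * Yn < 0 := by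
        have e : b (φ n) - B l₀ = r * h (φ n) - κ / 2 * |h (φ n)| := by simp only [b]; ring
        rw [e] at h1
        change form W (f n) (f n) + h (φ n) * Xn - _ < 0 at h1
        linarith
      have h4 : -(|h (φ n)| * |Xn - r * Yn|) ≤ h (φ n) * (Xn - r * Yn) := by
        rw [← abs_mul]; exact neg_abs_le _
      by_contra! h5
      nlinarith [mul_le_mul_of_nonneg_left h5.le (abs_nonneg (h (φ n)))]
  -- By uniqueness v is a multiple of u, so its masses have the same ratio r. The right side
  -- vanishes while the annulus mass of v is positive.
  obtain ⟨c, hc⟩ := hG.exists_ae_eq_const_mul hW hWs hn (by linarith) ⟨f, hGv⟩ hu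
  have hscale : ∀ T : E3 → ℝ, ∫ x, T x * v x ^ 2 ∂(ballMeasure ρ) =
      c ^ 2 * ∫ x, T x * u x ^ 2 ∂(ballMeasure ρ) := fun T => by
    rw [← integral_const_mul]
    refine integral_congr_ae ?_
    filter_upwards [hc] with x hx
    rw [hx]; ring
  have e : (∫ x, chiR R x * v x ^ 2 ∂(ballMeasure ρ)) -
      r * ∫ x, etaR R x * v x ^ 2 ∂(ballMeasure ρ) = 0 := by
    rw [hscale, hscale]
    change c ^ 2 * X - r * (c ^ 2 * Y) = 0
    rw [hXY]; ring
  rw [e, abs_zero] at hineq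
  nlinarith

end perturbed

/-! ### Upper bound for the mass in the ball of radius R -/

section truncation

lemma rpow_deriv_aux {t : ℝ} (ht : 0 ≤ t) (p : ℝ) :
    HasDerivAt (fun s : ℝ => (1 + s) ^ p) (p * (1 + t) ^ (p - 1)) t := by
  have h1 : HasDerivAt (fun s : ℝ => 1 + s) 1 t := (hasDerivAt_id t).const_add 1
  simpa using h1.rpow_const (p := p) (Or.inl (by positivity))

/-- The bounded truncation `t ↦ 1 - (1 + t) ^ (-1/3)`. -/
def truncBdd (t : ℝ) : ℝ := 1 - (1 + t) ^ (-(1 / 3) : ℝ)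

/-- The truncation `t ↦ (1 + t) ^ (1/3) - 1`, whose squared derivative is a third of the derivative
of `truncBdd`. -/
def truncRoot (t : ℝ) : ℝ := (1 + t) ^ (1 / 3 : ℝ) - 1

lemma hasDerivAt_truncBdd {t : ℝ} (ht : 0 ≤ t) :
    HasDerivAt truncBdd (1 / 3 * (1 + t) ^ (-(4 / 3) : ℝ)) t := by
  have h := (rpow_deriv_aux ht (-(1 / 3))).const_sub 1
  have e : 1 / 3 * (1 + t) ^ (-(4 / 3) : ℝ) = -(-(1 / 3) * (1 + t) ^ (-(1 / 3) - 1 : ℝ)) := by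
    norm_num
  rw [e]
  exact h

lemma hasDerivAt_truncRoot {t : ℝ} (ht : 0 ≤ t) :
    HasDerivAt truncRoot (1 / 3 * (1 + t) ^ (-(2 / 3) : ℝ)) t := by
  have h := (rpow_deriv_aux ht (1 / 3)).sub_const 1
  have e : 1 / 3 * (1 + t) ^ (-(2 / 3) : ℝ) = 1 / 3 * (1 + t) ^ (1 / 3 - 1 : ℝ) := by norm_num
  rw [e]
  exact h

lemma truncRoot_deriv_sq {t : ℝ} (ht : 0 ≤ t) :
    3 * (1 / 3 * (1 + t) ^ (-(2 / 3) : ℝ)) ^ 2 = 1 / 3 * (1 + t) ^ (-(4 / 3) : ℝ) := by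
  have : ((1 + t) ^ (-(2 / 3) : ℝ)) ^ 2 = (1 + t) ^ (-(4 / 3) : ℝ) := by
    rw [← Real.rpow_natCast, ← Real.rpow_mul (by positivity)]; norm_num
  rw [mul_pow, this]; ring

lemma truncBdd_le_one {t : ℝ} (ht : 0 ≤ t) : truncBdd t ≤ 1 := by
  have : 0 ≤ (1 + t) ^ (-(1 / 3) : ℝ) := by positivity
  unfold truncBdd; linarith

/-- With p the truncated root, t = p³ + 3p² + 3p, so t² ≤ 3(p⁶ + 9p⁴ + 9p²), and p⁴ and p² are each
at most 1 + p⁶. The cube root is chosen so that the Sobolev exponent 6 controls t². -/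
lemma sq_le_truncRoot {t : ℝ} (ht : 0 ≤ t) : t ^ 2 ≤ 54 + 57 * truncRoot t ^ 6 := by
  set p := truncRoot t
  have hp : 0 ≤ p := sub_nonneg.2 (Real.one_le_rpow (by linarith) (by norm_num))
  have h1 : (1 + p) ^ 3 = 1 + t := by
    have : 1 + p = (1 + t) ^ (1 / 3 : ℝ) := by simp only [p, truncRoot]; ring
    rw [this, ← Real.rpow_natCast, ← Real.rpow_mul (by positivity)]; norm_num
  have h2 : t = p ^ 3 + 3 * p ^ 2 + 3 * p := by linarith
  have h3 : ∀ q : ℝ, 0 ≤ q → q ≤ 1 + q ^ 3 := fun q hq => by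
    nlinarith [mul_nonneg hq (sq_nonneg (q - 1)), sq_nonneg (q - 1)]
  have h4 : ∀ q : ℝ, 0 ≤ q → q ^ 2 ≤ 1 + q ^ 3 := fun q hq => by
    nlinarith [mul_nonneg hq (sq_nonneg (q - 1)), sq_nonneg (q - 1)]
  have h5 := h3 (p ^ 2) (sq_nonneg p)
  have h6 := h4 (p ^ 2) (sq_nonneg p)
  rw [h2]
  nlinarith [sq_nonneg (p ^ 3 - 3 * p ^ 2), sq_nonneg (p ^ 3 - 3 * p),
    sq_nonneg (3 * p ^ 2 - 3 * p)]

lemma IsTest.rpow_one_add {f : E3 → ℝ} (hf : IsTest f) (hf0 : ∀ x, 0 ≤ f x) (p : ℝ) :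
    IsTest (fun x => (1 + f x) ^ p - 1) where
  smooth := ((contDiff_const.add hf.smooth).rpow_const_of_ne
    (fun x => (add_pos_of_pos_of_nonneg one_pos (hf0 x)).ne')).sub contDiff_const
  supp := hf.supp.comp_left (g := fun t : ℝ => (1 + t) ^ p - 1) (by simp)

lemma IsTest.truncRoot {f : E3 → ℝ} (hf : IsTest f) (hf0 : ∀ x, 0 ≤ f x) :
    IsTest (fun x => truncRoot (f x)) := hf.rpow_one_add hf0 _

lemma IsTest.truncBdd {f : E3 → ℝ} (hf : IsTest f) (hf0 : ∀ x, 0 ≤ f x) :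
    IsTest (fun x => truncBdd (f x)) := by
  have := (hf.rpow_one_add hf0 (-(1 / 3))).const_mul (-1)
  convert this using 2 with x
  unfold CriticalCoupling.truncBdd; ring

/-- Testing against the bounded truncation yields a full Dirichlet form of the root truncation,
because the derivative of the former is three times the squared derivative of the latter. -/
lemma dirichlet_truncBdd {f : E3 → ℝ} (hf : IsTest f) (hf0 : ∀ x, 0 ≤ f x) :
    dirichlet f (fun x => truncBdd (f x)) =
      3 * dirichlet (fun x => truncRoot (f x)) (fun x => truncRoot (f x)) := by
  unfold dirichlet
  rw [← integral_const_mul]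
  congr 1; ext x
  rw [gdot_comp_right (hf.differentiable x) (hasDerivAt_truncBdd (hf0 x)),
    gdot_comp_self (hf.differentiable x) (hasDerivAt_truncRoot (hf0 x)),
    ← truncRoot_deriv_sq (hf0 x)]
  ring

lemma dirichlet_truncBdd_self_le {f : E3 → ℝ} (hf : IsTest f) (hf0 : ∀ x, 0 ≤ f x) :
    dirichlet (fun x => truncBdd (f x)) (fun x => truncBdd (f x)) ≤ dirichlet f f := by
  have := dirichlet_comp_le (L := 1) hf (fun x => hasDerivAt_truncBdd (hf0 x)) fun x => by
    have h1 : (1 + f x) ^ (-(4 / 3) : ℝ) ≤ 1 :=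
      Real.rpow_le_one_of_one_le_of_nonpos (by linarith [hf0 x]) (by norm_num)
    have h2 : 0 ≤ (1 + f x) ^ (-(4 / 3) : ℝ) := by have := hf0 x; positivity
    nlinarith
  simpa using this

end truncation

lemma potForm_nonpos (hneg : ∀ x, V₀ x ≤ 0) (f : E3 → ℝ) : potForm V₀ f f ≤ 0 :=
  integral_nonpos fun x => mul_nonpos_of_nonpos_of_nonneg (hneg x) (mul_self_nonneg _)

lemma integrable_pot_one (hV : IsPotential V₀) {f : E3 → ℝ} (hf : IsTest f) :
    Integrable (fun x => V₀ x * f x) := by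
  obtain ⟨M, hM⟩ := hV.bdd
  exact hf.integrable.bdd_mul hV.meas.aestronglyMeasurable (Eventually.of_forall hM)

/-- The mass of a ground state in the ball of radius `R` grows at most linearly in `R`. -/
theorem exists_potForm_chiR_le (hV : IsPotential V₀) (hneg : ∀ x, V₀ x ≤ 0) (hn : FormNonneg V₀)
    (G : ℝ) (hG : 0 ≤ G) :
    ∃ C : ℝ, 0 ≤ C ∧ ∀ R : ℝ, 1 ≤ R → ∀ f : ℕ → E3 → ℝ, (∀ n, IsTest (f n)) →
      (∀ n x, 0 ≤ f n x) → Tendsto (fun n => form V₀ (f n) (f n)) atTop (𝓝 0) →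
      (∃ K, ∀ n, dirichlet (f n) (f n) ≤ K) → (∀ n, -∫ x, V₀ x * f n x ≤ G) →
      ∀ᶠ n in atTop, potForm (chiR R) (f n) (f n) ≤ C * R := by
  obtain ⟨S, hS0, hS⟩ := exists_sobolev_const
  refine ⟨54 * volume.real (Metric.closedBall (0 : E3) 1) + 57 * (S * (1 + G) ^ 3),
    by positivity, fun R hR f hf hf0 hlim ⟨K, hK⟩ hfG => ?_⟩
  have hR0 : 0 < R := by linarith
  -- A function decaying like 1/|x| becomes of order one at |x| = R after multiplication by R, the
  -- scale at which the truncations act.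
  set v : ℕ → E3 → ℝ := fun n x => R * f n x
  have hv : ∀ n, IsTest (v n) := fun n => (hf n).const_mul R
  have hv0 : ∀ n x, 0 ≤ v n x := fun n x => mul_nonneg hR0.le (hf0 n x)
  have hvlim : Tendsto (fun n => form V₀ (v n) (v n)) atTop (𝓝 0) := by
    simp only [v, form_const_mul]
    simpa using hlim.const_mul (R ^ 2)
  have hbd : ∀ n, form V₀ (fun x => truncBdd (v n x)) (fun x => truncBdd (v n x)) ≤ R ^ 2 * K := by
    intro n
    have h1 := potForm_nonpos hneg (fun x => truncBdd (v n x))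
    have h2 := dirichlet_truncBdd_self_le (hv n) (hv0 n)
    have h3 := dirichlet_const_mul (f n) R
    have h4 := mul_le_mul_of_nonneg_left (hK n) (sq_nonneg R)
    unfold form
    linarith
  have hT := hn.tendsto_zero hV hv (fun n => (hv n).truncBdd (hv0 n)) hvlim hbd
  filter_upwards [hT.eventually (gt_mem_nhds one_pos)] with n hn1
  have hpot : -potForm V₀ (v n) (fun x => truncBdd (v n x)) ≤ R * G := by
    calc _ = ∫ x, -(V₀ x * (v n x * truncBdd (v n x))) := by
          rw [integral_neg]; rfl
      _ ≤ ∫ x, R * -(V₀ x * f n x) := by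
          refine integral_mono (((hv n).integrable_pot hV ((hv n).truncBdd (hv0 n))).neg)
            ((integrable_pot_one hV (hf n)).neg.const_mul R) fun x => ?_
          have h1 := truncBdd_le_one (hv0 n x)
          have h2 : 0 ≤ -V₀ x * v n x := mul_nonneg (by linarith [hneg x]) (hv0 n x)
          calc -(V₀ x * (v n x * truncBdd (v n x))) = -V₀ x * v n x * truncBdd (v n x) := by ring
            _ ≤ -V₀ x * v n x * 1 := by gcongr
            _ = R * -(V₀ x * f n x) := by simp only [v]; ring
      _ = R * -∫ x, V₀ x * f n x := by rw [integral_const_mul, integral_neg]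
      _ ≤ R * G := by gcongr; exact hfG n
  set E := dirichlet (fun x => truncRoot (v n x)) (fun x => truncRoot (v n x))
  have hE0 : 0 ≤ E := dirichlet_self_nonneg _
  -- The tested form is below 1, so 3E ≤ 1 + RG. Boundedness of the truncation makes the potential
  -- contribution linear in R instead of quadratic.
  have hE : E ≤ R * (1 + G) := by
    have h1 := dirichlet_truncBdd (hv n) (hv0 n)
    unfold form at hn1
    nlinarith
  have hsob := hS _ ((hv n).truncRoot (hv0 n))
  have hchi : ∫ x, chiR R x = R ^ 3 * volume.real (Metric.closedBall (0 : E3) 1) := by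
    have : chiR R = Set.indicator (Metric.closedBall (0 : E3) R) (fun _ => (1 : ℝ)) := by
      unfold chiR
      congr 1
      ext x; simp
    rw [this, integral_indicator measurableSet_closedBall]
    simp only [integral_const, smul_eq_mul, mul_one, measureReal_restrict_apply_univ]
    rw [Measure.addHaar_real_closedBall' _ _ hR0.le]
    simp
  have hchii : Integrable (chiR R) := by
    have : chiR R = Set.indicator (Metric.closedBall (0 : E3) R) (fun _ => (1 : ℝ)) := by
      unfold chiR
      congr 1
      ext x; simp
    rw [this, integrable_indicator_iff measurableSet_closedBall]
    exact integrableOn_const measure_closedBall_lt_top.ne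
  have i6 : Integrable (fun x => truncRoot (v n x) ^ 6) :=
    (((hv n).truncRoot (hv0 n)).pow (by norm_num)).integrable
  have hmain : R ^ 2 * potForm (chiR R) (f n) (f n) ≤
      54 * (R ^ 3 * volume.real (Metric.closedBall (0 : E3) 1)) +
        57 * (S * (R * (1 + G)) ^ 3) := by
    rw [← potForm_const_mul]
    calc potForm (chiR R) (v n) (v n)
        ≤ ∫ x, (54 * chiR R x + 57 * truncRoot (v n x) ^ 6) := by
          refine integral_mono ((hv n).integrable_pot (isPotential_chiR R) (hv n))
            ((hchii.const_mul 54).add (i6.const_mul 57)) fun x => ?_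
          have h1 := sq_le_truncRoot (hv0 n x)
          have h2 := chiR_nonneg R x
          have h3 : chiR R x ≤ 1 := by
            unfold chiR Set.indicator; split_ifs <;> simp
          have h4 : 0 ≤ truncRoot (v n x) ^ 6 := by positivity
          have h5 := mul_le_mul_of_nonneg_left h1 h2
          simp only
          nlinarith [mul_le_mul_of_nonneg_right h3 h4]
      _ = 54 * (R ^ 3 * volume.real (Metric.closedBall (0 : E3) 1)) +
            57 * ∫ x, truncRoot (v n x) ^ 6 := by
          rw [integral_add (hchii.const_mul 54) (i6.const_mul 57), integral_const_mul,
            integral_const_mul, hchi]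
      _ ≤ _ := by
          gcongr
          exact hsob.trans (by gcongr)
  have hR2 : 0 < R ^ 2 := by positivity
  rw [← mul_le_mul_iff_right₀ hR2]
  refine hmain.trans_eq ?_
  ring

/-! ### Lower bound for the mass in the annulus -/

section laplacian

lemma pd_comp_smul {g : E3 → ℝ} (c : ℝ) {x : E3} (hg : Differentiable ℝ g) (i : Fin 3) :
    pd i (fun x => g (c • x)) x = c * pd i g (c • x) := by
  have h1 : HasFDerivAt (fun x : E3 => c • x) (c • ContinuousLinearMap.id ℝ E3) x :=
    (hasFDerivAt_id x).const_smul c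
  have h2 := (hg (c • x)).hasFDerivAt.comp x h1
  have h3 : HasFDerivAt (fun x => g (c • x))
    ((fderiv ℝ g (c • x)).comp (c • ContinuousLinearMap.id ℝ E3)) x := h2
  simp [pd, h3.fderiv]

lemma IsTest.comp_smul {g : E3 → ℝ} (hg : IsTest g) {c : ℝ} (hc : c ≠ 0) :
    IsTest (fun x => g (c • x)) where
  smooth := hg.smooth.comp (contDiff_id.const_smul c)
  supp := hg.supp.comp_smul hc

lemma dirichlet_eq_neg_integral {f g : E3 → ℝ} (hf : IsTest f) (hg : IsTest g) :
    dirichlet f g = -∫ x, f x * ∑ i, pd i (pd i g) x := by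
  have h : ∀ i, ∫ x, pd i f x * pd i g x = -∫ x, f x * pd i (pd i g) x := fun i => by
    have := integral_mul_fderiv_eq_neg_fderiv_mul_of_integrable (μ := (volume : Measure E3))
      (f := f) (g := pd i g) (v := EuclideanSpace.single i 1)
      ((hf.pd i).mul_smooth (hg.pd i).smooth).integrable
      (hf.mul_smooth ((hg.pd i).pd i).smooth).integrable
      (hf.mul_smooth (hg.pd i).smooth).integrable
      (fun x _ => hf.differentiable x) (fun x _ => (hg.pd i).differentiable x)
    change ∫ x, f x * pd i (pd i g) x = -∫ x, pd i f x * pd i g x at this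
    rw [this, neg_neg]
  unfold dirichlet gdot
  rw [integral_finsetSum _ fun i _ => ((hf.pd i).mul_smooth (hg.pd i).smooth).integrable]
  simp only [h, Finset.mul_sum]
  rw [integral_finsetSum _ fun i _ => (hf.mul_smooth ((hg.pd i).pd i).smooth).integrable]
  simp

lemma pd_eq_zero_of_eqOn {g : E3 → ℝ} {U : Set E3} (hU : IsOpen U) {c : ℝ}
    (hg : ∀ x ∈ U, g x = c) (i : Fin 3) : ∀ x ∈ U, pd i g x = 0 := fun x hx => by
  have : g =ᶠ[𝓝 x] fun _ => c := by
    filter_upwards [hU.mem_nhds hx] with y hy using hg y hy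
  simp [pd, this.fderiv_eq]

end laplacian

/-- The mass of a ground state in the annulus between `R` and `2R` grows at least linearly
in `R`. -/
theorem exists_le_potForm_etaR (hV : IsPotential V₀) (hn : FormNonneg V₀) :
    ∃ C : ℝ, 0 < C ∧ ∀ R : ℝ, 1 ≤ R → SuppIn V₀ R → ∀ f : ℕ → E3 → ℝ, (∀ n, IsTest (f n)) →
      Tendsto (fun n => form V₀ (f n) (f n)) atTop (𝓝 0) →
      ∀ G Y : ℝ, Tendsto (fun n => -∫ x, V₀ x * f n x) atTop (𝓝 G) →
      Tendsto (fun n => potForm (etaR R) (f n) (f n)) atTop (𝓝 Y) → R * G ^ 2 ≤ C * Y := by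
  -- Radii strictly between 1 and 2 make ζ constant on open sets containing |x| ≤ 1 and |x| > 2, so
  -- its Laplacian vanishes at the borders too.
  obtain ⟨ζ, hζ, -, -, hζ1, hζ0⟩ := exists_cutoff (r := 5 / 4) (R := 7 / 4) (by norm_num)
    (by norm_num)
  set Δζ : E3 → ℝ := fun x => ∑ i, pd i (pd i ζ) x
  have hΔ1 : ∀ x, ‖x‖ ≤ 1 → Δζ x = 0 := fun x hx => by
    refine Finset.sum_eq_zero fun i _ => ?_
    have hU : IsOpen {x : E3 | ‖x‖ < 5 / 4} := isOpen_lt continuous_norm continuous_const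
    exact pd_eq_zero_of_eqOn hU (pd_eq_zero_of_eqOn hU (fun y hy => hζ1 y (le_of_lt hy)) i) i x
      (show ‖x‖ < 5 / 4 by linarith)
  have hΔ2 : ∀ x, 2 < ‖x‖ → Δζ x = 0 := fun x hx => by
    refine Finset.sum_eq_zero fun i _ => ?_
    have hU : IsOpen {x : E3 | 7 / 4 < ‖x‖} := isOpen_lt continuous_const continuous_norm
    exact pd_eq_zero_of_eqOn hU (pd_eq_zero_of_eqOn hU (fun y hy => hζ0 y (le_of_lt hy)) i) i x
      (show 7 / 4 < ‖x‖ by linarith)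
  obtain ⟨D, hD⟩ : ∃ D, ∀ x, |Δζ x| ≤ D := by
    choose D hD using fun i : Fin 3 => ((hζ.pd i).pd i).continuous.bounded_above_of_compact_support
      ((hζ.pd i).pd i).supp
    exact ⟨∑ i, D i, fun x => (Finset.abs_sum_le_sum_abs _ _).trans
      (Finset.sum_le_sum fun i _ => hD i x)⟩
  have hD0 : 0 ≤ D := (abs_nonneg _).trans (hD 0)
  set vol₁ := volume.real (Metric.closedBall (0 : E3) 1)
  refine ⟨8 * D ^ 2 * vol₁ + 1, by positivity, fun R hR hs f hf hlim G Y hGlim hYlim => ?_⟩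
  have hR0 : 0 < R := by linarith
  set φ : E3 → ℝ := fun x => ζ (R⁻¹ • x)
  have hφ : IsTest φ := hζ.comp_smul (by positivity)
  have hφΔ : ∀ x, ∑ i, pd i (pd i φ) x = (R⁻¹) ^ 2 * Δζ (R⁻¹ • x) := fun x => by
    simp only [Δζ, Finset.mul_sum]
    refine Finset.sum_congr rfl fun i _ => ?_
    have h1 : pd i φ = fun x => R⁻¹ * pd i ζ (R⁻¹ • x) := by
      ext y; exact pd_comp_smul _ hζ.differentiable i
    have h2 := pd_lin (f := fun x => pd i ζ (R⁻¹ • x)) (g := fun x => pd i ζ (R⁻¹ • x)) (x := x)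
      (((hζ.pd i).comp_smul (inv_ne_zero hR0.ne')).differentiable x)
      (((hζ.pd i).comp_smul (inv_ne_zero hR0.ne')).differentiable x) R⁻¹ 0 i
    simp only [zero_mul, add_zero] at h2
    rw [h1, h2, pd_comp_smul _ (hζ.pd i).differentiable]
    ring
  have hφΔle : ∀ x, |∑ i, pd i (pd i φ) x| ≤ (R⁻¹) ^ 2 * D * etaR R x := fun x => by
    rw [hφΔ, abs_mul, abs_of_nonneg (sq_nonneg _), mul_assoc]
    refine mul_le_mul_of_nonneg_left ?_ (sq_nonneg _)
    have hnorm : ‖R⁻¹ • x‖ = ‖x‖ / R := by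
      rw [norm_smul, Real.norm_of_nonneg (by positivity)]; field_simp
    by_cases hx : R < ‖x‖ ∧ ‖x‖ ≤ 2 * R
    · have : etaR R x = 1 := Set.indicator_of_mem
        (show x ∈ {r : E3 | R < ‖r‖ ∧ ‖r‖ ≤ 2 * R} from hx) _
      rw [this, mul_one]; exact hD _
    · have h0 : Δζ (R⁻¹ • x) = 0 := by
        rw [not_and_or, not_lt, not_le] at hx
        rcases hx with hx | hx
        · refine hΔ1 _ ?_
          rw [hnorm, div_le_one hR0]; exact hx
        · refine hΔ2 _ ?_
          rw [hnorm, lt_div_iff₀ hR0]; exact hx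
      rw [h0, abs_zero]
      exact mul_nonneg hD0 (etaR_nonneg R x)
  have hηsq : ∀ x, etaR R x ^ 2 = etaR R x := fun x => by
    unfold etaR Set.indicator; split_ifs <;> simp
  obtain ⟨Mη, hMη⟩ := (isPotential_etaR R).bdd
  have hηL : MemLp (etaR R) 2 (ballMeasure (2 * R)) :=
    MemLp.of_bound (isPotential_etaR R).meas.aestronglyMeasurable Mη (Eventually.of_forall hMη)
  -- After integration by parts and Cauchy–Schwarz on the annulus, the Laplacian contributes (D
  -- R⁻²)² and the volume at most 8R³ vol₁, leaving 1/R.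
  have hdir : ∀ n, dirichlet (f n) φ ^ 2 ≤ 8 * D ^ 2 * vol₁ / R * potForm (etaR R) (f n) (f n) := by
    intro n
    have hfL := (hf n).memLp (2 * R)
    have habs : |dirichlet (f n) φ| ≤ (R⁻¹) ^ 2 * D * ∫ x, etaR R x * |f n x| := by
      rw [dirichlet_eq_neg_integral (hf n) hφ, abs_neg, ← integral_const_mul,
        ← Real.norm_eq_abs]
      refine norm_integral_le_of_norm_le ?_ (Eventually.of_forall fun x => ?_)
      · exact ((hf n).integrable.abs.bdd_mul (isPotential_etaR R).meas.aestronglyMeasurable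
          (Eventually.of_forall hMη)).const_mul _
      · rw [norm_mul, Real.norm_eq_abs, Real.norm_eq_abs]
        calc _ ≤ |f n x| * ((R⁻¹) ^ 2 * D * etaR R x) :=
              mul_le_mul_of_nonneg_left (hφΔle x) (abs_nonneg _)
          _ = _ := by ring
    have hfabs : MemLp (fun x => |f n x|) 2 (ballMeasure (2 * R)) := hfL.abs
    have hcs := sq_integral_mul_le hηL (memLp_bdd_mul (isPotential_etaR R).meas hMη hfabs)
    have e1 : ∫ x, etaR R x * (etaR R x * |f n x|) ∂(ballMeasure (2 * R)) =
        ∫ x, etaR R x * |f n x| := by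
      rw [(suppIn_etaR le_rfl).integral_eq]
      refine integral_congr_ae (Eventually.of_forall fun x => ?_)
      simp only
      rw [← mul_assoc, ← sq, hηsq]
    have e2 : ∫ x, (etaR R x * |f n x|) ^ 2 ∂(ballMeasure (2 * R)) =
        potForm (etaR R) (f n) (f n) := by
      rw [(suppIn_etaR le_rfl).potForm_self]
      simp only [mul_pow, hηsq, sq_abs]
    have e3 : ∫ x, etaR R x ^ 2 ∂(ballMeasure (2 * R)) ≤ 8 * R ^ 3 * vol₁ := by
      calc _ ≤ ∫ _, (1 : ℝ) ∂(ballMeasure (2 * R)) := by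
            refine integral_mono hηL.integrable_sq (integrable_const _) fun x => ?_
            simp only
            rw [hηsq]
            unfold etaR Set.indicator; split_ifs <;> simp
        _ = 8 * R ^ 3 * vol₁ := by
            simp only [integral_const, smul_eq_mul, mul_one, measureReal_restrict_apply_univ]
            rw [Measure.addHaar_real_closedBall' _ _ (by positivity)]
            simp only [finrank_euclideanSpace, Fintype.card_fin, vol₁]
            ring
    rw [e1, e2] at hcs
    have hP := potForm_nonneg (etaR_nonneg R) (f n)
    calc dirichlet (f n) φ ^ 2 = |dirichlet (f n) φ| ^ 2 := (sq_abs _).symm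
      _ ≤ ((R⁻¹) ^ 2 * D * ∫ x, etaR R x * |f n x|) ^ 2 := by gcongr
      _ = ((R⁻¹) ^ 2 * D) ^ 2 * (∫ x, etaR R x * |f n x|) ^ 2 := by ring
      _ ≤ ((R⁻¹) ^ 2 * D) ^ 2 * (8 * R ^ 3 * vol₁ * potForm (etaR R) (f n) (f n)) := by
          gcongr
          exact hcs.trans (by gcongr)
      _ = _ := by field_simp
  have hpotφ : ∀ n, potForm V₀ (f n) φ = ∫ x, V₀ x * f n x := fun n => by
    unfold potForm
    refine integral_congr_ae (Eventually.of_forall fun x => ?_)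
    by_cases hx : R < ‖x‖
    · simp [hs x hx]
    · have : φ x = 1 := by
        refine hζ1 _ ?_
        rw [norm_smul, Real.norm_of_nonneg (by positivity), ← div_eq_inv_mul]
        have := (div_le_one hR0).2 (not_lt.1 hx)
        linarith
      simp [this]
  -- Since φ = 1 on the support of V₀, the weak equation tested with φ says that dirichlet (f n) φ
  -- converges to G, a flux independent of R.
  have hT := hn.tendsto_zero hV hf (fun _ => hφ) hlim (K := form V₀ φ φ) fun _ => le_rfl
  have hdlim : Tendsto (fun n => dirichlet (f n) φ) atTop (𝓝 G) := by
    have := hT.add hGlim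
    simp only [form, hpotφ] at this
    simpa using this
  have h1 := le_of_tendsto_of_tendsto' (hdlim.pow 2) (hYlim.const_mul (8 * D ^ 2 * vol₁ / R)) hdir
  have hY0 : 0 ≤ Y := ge_of_tendsto' hYlim fun n => potForm_nonneg (etaR_nonneg R) (f n)
  have h2 := mul_le_mul_of_nonneg_left h1 hR0.le
  have h3 : R * (8 * D ^ 2 * vol₁ / R * Y) = 8 * D ^ 2 * vol₁ * Y := by field_simp
  rw [h3] at h2
  linarith

/-! ### Boundedness of the derivative at zero -/

lemma perturbedPotential_zero (V₀ : E3 → ℝ) (R : ℝ) : perturbedPotential V₀ R 0 0 = V₀ := by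
  ext x; simp [perturbedPotential]

/-- The derivative of the critical coupling at `0` is bounded for large `R`. -/
theorem exists_abs_deriv_critB_le (hV : IsPotential V₀) (hneg : ∀ x, V₀ x ≤ 0)
    {r : ℝ} (hs : SuppIn V₀ r) (hcrit : AtCriticalCoupling V₀) :
    ∃ C R₀ : ℝ, ∀ R, R₀ ≤ R → |deriv (critB V₀ R) 0| ≤ C := by
  set ρ₀ := max r 1
  have hρ₀ : 1 ≤ ρ₀ := le_max_right _ _
  have hs₀ : ∀ ρ, ρ₀ ≤ ρ → SuppIn V₀ ρ := fun ρ hρ x hx =>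
    hs x (((le_max_left r 1).trans hρ).trans_lt hx)
  obtain ⟨hn, u₀, ⟨f₀, hf₀⟩, hu₀⟩ := (atCriticalCoupling_iff hV (hs₀ ρ₀ le_rfl)).1 hcrit
  obtain ⟨f, hf, hf0⟩ := hf₀.exists_abs hV (hs₀ ρ₀ le_rfl) hn
  set w : E3 → ℝ := fun x => |u₀ x|
  have hwneg : ∫ x, V₀ x * w x ^ 2 ∂(ballMeasure ρ₀) < 0 :=
    hf.integral_neg hV (hs₀ ρ₀ le_rfl) (by simpa [w] using hu₀)
  obtain ⟨K, hK⟩ := hf.exists_dirichlet_le hV (hs₀ ρ₀ le_rfl)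
  obtain ⟨M, hM⟩ := hV.bdd
  have hVL : MemLp V₀ 2 (ballMeasure ρ₀) :=
    MemLp.of_bound hV.meas.aestronglyMeasurable M (Eventually.of_forall hM)
  set G := -∫ x, V₀ x * w x ∂(ballMeasure ρ₀)
  have hGlim : Tendsto (fun n => -∫ x, V₀ x * f n x) atTop (𝓝 G) := by
    have := (tendsto_integral_mul (fun n => (hf.test n).memLp ρ₀) hf.memLp hVL hf.tendsto).neg
    simpa only [(hs₀ ρ₀ le_rfl).integral_eq] using this
  have hGpos : 0 < G := by
    have hnn : ∀ x, 0 ≤ -(V₀ x * w x) := fun x => by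
      have := mul_nonneg (neg_nonneg.2 (hneg x)) (abs_nonneg (u₀ x))
      simpa [w] using this
    have hGe : G = ∫ x, -(V₀ x * w x) ∂(ballMeasure ρ₀) := (integral_neg _).symm
    rw [hGe]
    refine (integral_nonneg hnn).lt_of_ne fun h0 => hwneg.ne ?_
    have h1 := (integral_eq_zero_iff_of_nonneg hnn
      (integrable_mul_of_memLp hVL hf.memLp).neg).1 h0.symm
    refine integral_eq_zero_of_ae ?_
    filter_upwards [h1] with x hx
    have hx' : V₀ x * w x = 0 := by simpa using hx
    simp only [Pi.zero_apply, sq, ← mul_assoc, hx', zero_mul]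
  obtain ⟨G', hG'⟩ := hGlim.bddAbove_range
  have hG'le : ∀ n, -∫ x, V₀ x * f n x ≤ max G' 0 := fun n => (hG' ⟨n, rfl⟩).trans (le_max_left _ _)
  obtain ⟨C₁, hC₁0, hC₁⟩ := exists_potForm_chiR_le hV hneg hn (max G' 0) (le_max_right _ _)
  obtain ⟨C₂, hC₂0, hC₂⟩ := exists_le_potForm_etaR hV hn
  refine ⟨C₁ * C₂ / G ^ 2, ρ₀, fun R hR => ?_⟩
  have hR1 : 1 ≤ R := hρ₀.trans hR
  have hR0 : 0 < R := by linarith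
  have hsR : SuppIn V₀ (2 * R) := hs₀ _ (by linarith)
  -- One sequence f and one flux G serve all R; only the subsequence and its limit on the larger
  -- ball depend on R, so the constants stay uniform.
  obtain ⟨φ, hφ, u, hu, hconv⟩ := exists_subseq_tendsto (2 * R) hf.test hK
  have hlim : Tendsto (fun n => form V₀ (f (φ n)) (f (φ n))) atTop (𝓝 0) :=
    hf.form_tendsto.comp hφ.tendsto_atTop
  have hGu : GroundLimit V₀ (2 * R) (fun n => f (φ n)) u := ⟨fun n => hf.test _, hlim, hu, hconv⟩
  have hupos : 0 < ∫ x, u x ^ 2 ∂(ballMeasure (2 * R)) := by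
    refine integral_sq_pos_of_integral_ne (W := V₀) hu ?_
    have := tendsto_nhds_unique (hGu.tendsto_quad hV hsR)
      ((hf.tendsto_quad hV (hs₀ ρ₀ le_rfl)).comp hφ.tendsto_atTop)
    rw [this]; exact hwneg.ne
  have hB0 : critB V₀ R 0 = 0 := (eq_critB_of_atCriticalCoupling hV hsR hR0 le_rfl
    (by rwa [perturbedPotential_zero])).symm
  obtain ⟨δ, hδ, hδn⟩ := exists_formNonneg_neg hV hsR hR0 le_rfl hn
  have hder := hasDerivAt_critB hV hsR hR0 le_rfl (l₀ := 0) (u := u)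
    (by
      filter_upwards [lt_mem_nhds (by linarith : -δ < 0)] with l hl
      exact ⟨-1, hδn l hl⟩)
    (by rw [hB0, perturbedPotential_zero]; exact ⟨_, hGu⟩) hupos
  rw [hder.deriv]
  have hXlim := hGu.tendsto_quad (isPotential_chiR R) (suppIn_chiR hR0 le_rfl)
  have hYlim := hGu.tendsto_quad (isPotential_etaR R) (suppIn_etaR le_rfl)
  have hYpos := IsGround.integral_etaR_pos hV hsR hn hR0 le_rfl ⟨_, hGu⟩ hupos
  set X := ∫ x, chiR R x * u x ^ 2 ∂(ballMeasure (2 * R))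
  set Y := ∫ x, etaR R x * u x ^ 2 ∂(ballMeasure (2 * R))
  have hX0 : 0 ≤ X := integral_nonneg fun x => mul_nonneg (chiR_nonneg R x) (sq_nonneg _)
  have hX : X ≤ C₁ * R := le_of_tendsto hXlim (hC₁ R hR1 (fun n => f (φ n)) (fun n => hf.test _)
    (fun n => hf0 _) hlim ⟨K, fun n => hK _⟩ (fun n => hG'le _))
  have hY : R * G ^ 2 ≤ C₂ * Y := hC₂ R hR1 (hs₀ R hR) (fun n => f (φ n)) (fun n => hf.test _)
    hlim G Y (hGlim.comp hφ.tendsto_atTop) hYlim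
  -- The derivative is X/Y with X ≤ C₁R and Y ≥ RG²/C₂, so the powers of R cancel.
  rw [abs_of_nonneg (div_nonneg hX0 hYpos.le), div_le_div_iff₀ hYpos (by positivity)]
  calc X * G ^ 2 ≤ C₁ * R * G ^ 2 := by gcongr
    _ = C₁ * (R * G ^ 2) := by ring
    _ ≤ C₁ * (C₂ * Y) := by gcongr
    _ = _ := by ring

end CriticalCoupling

/-! ### The main theorem -/

open CriticalCoupling

theorem proposition1 (V₀ : E3 → ℝ) (hmeas : Measurable V₀)
    (hbdd : ∃ M : ℝ, ∀ r, |V₀ r| ≤ M)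
    (hneg : ∀ r, V₀ r ≤ 0)
    (hrange : ∃ rV : ℝ, ∀ r, rV ≤ ‖r‖ → V₀ r = 0)
    (hcrit : AtCriticalCoupling V₀) :
    ∃ B : ℝ → ℝ → ℝ,
      (∀ R : ℝ, 0 < R →
        (∀ l : ℝ, 0 ≤ l → 0 ≤ B R l) ∧
        ∃ δ : ℝ, 0 < δ ∧
          (∀ l : ℝ, -δ < l → ∀ b : ℝ,
            AtCriticalCoupling (perturbedPotential V₀ R l b) ↔ b = B R l) ∧
          (∀ l : ℝ, -δ < l → l < δ → DifferentiableAt ℝ (B R) l)) ∧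
      ∃ C R₀ : ℝ, ∀ R : ℝ, R₀ ≤ R → |deriv (B R) 0| ≤ C := by
  have hV : IsPotential V₀ := ⟨hmeas, hbdd⟩
  obtain ⟨rV, hrV⟩ := hrange
  have hs : SuppIn V₀ rV := fun x hx => hrV x hx.le
  have hn : FormNonneg V₀ := (schrodingerNonneg_iff hV).1 hcrit.1
  refine ⟨critB V₀, fun R hR => ⟨fun l hl => ?_, ?_⟩, exists_abs_deriv_critB_le hV hneg hs hcrit⟩
  -- For l ≥ 0 the added term is nonnegative, so b = 0 is admissible.
  · refine le_critB hV hR fun f hf => ?_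
    rw [form_perturbed hV R l 0 hf]
    have h1 := hn f hf
    have h2 := mul_nonneg hl (potForm_nonneg (chiR_nonneg R) f)
    linarith
  · set ρ := max rV (2 * R)
    have hρ : 2 * R ≤ ρ := le_max_right _ _
    have hsρ : SuppIn V₀ ρ := fun x hx => hs x ((le_max_left _ _).trans_lt hx)
    -- For l > -δ the set of admissible b contains -1, so `critB` is a genuine supremum and not the
    -- default value of `sSup` on the empty set.
    obtain ⟨δ, hδ, hδn⟩ := exists_formNonneg_neg hV hsρ hR hρ hn
    have hcB : ∀ l, -δ < l → AtCriticalCoupling (perturbedPotential V₀ R l (critB V₀ R l)) :=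
      fun l hl => atCriticalCoupling_critB hV hsρ hR hρ (hδn l hl)
    refine ⟨δ, hδ, fun l hl b => ⟨eq_critB_of_atCriticalCoupling hV hsρ hR hρ, ?_⟩,
      fun l hl _ => ?_⟩
    · rintro rfl
      exact hcB l hl
    · obtain ⟨-, u, hu, hupos⟩ := (atCriticalCoupling_iff (isPotential_perturbed hV R l _)
        (suppIn_perturbed hsρ hR hρ l _)).1 (hcB l hl)
      refine (hasDerivAt_critB hV hsρ hR hρ ?_ hu hupos).differentiableAt
      filter_upwards [lt_mem_nhds hl] with l' hl'
      exact ⟨-1, hδn l' hl'⟩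

end
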